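/- **Setting.** Let $\Omega$ be a Polish space with its Borel $\sigma$-algebra, let $\mu$ be a probability measure on $\Omega$, and let $(Z_t)_{t\ge 0}$ be a time-homogeneous Markov process on $\Omega$, given by its transition kernels (the laws of $Z_t$ given $Z_0=z$; they are the identity at $t=0$ and satisfy the Chapman–Kolmogorov equation). For real-valued or $d\times d$ complex matrix-valued $f$ put $(P_tf)(z)=\mathbb E[f(Z_t)\mid Z_0=z]$, where expectations of matrices are taken entrywise. Assume that * $\mu$ is stationary for $(P_t)$; * $(P_t)$ is reversible: $\mathbb E_\mu[(P_tf)g]=\mathbb E_\mu[f(P_tg)]$ for all $t\ge0$ and all real-valued $f,g\in L_2(\mu)$; * $(P_t)$ is ergodic: $P_tf\to\mathbb E_\mu f$ in $L_2(\mu)$ as $t\to\infty$ for all real-valued $f\in L_2(\mu)$. The generator is $(\mathcal Lf)(z)=\lim_{t\downarrow0}\big((P_tf)(z)-f(z)\big)/t$. Fix an algebra $\mathcal A$ of *suitable* functions, that is, an algebra of measurable functions $\Omega\to\mathbb R$ containing the constants such that for every $f\in\mathcal A$: $f\in L_2(\mu)$; $f(Z_t)$ is integrable given $Z_0=z$, for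 all $t\ge0$ and $z\in\Omega$; the limit defining $\mathcal Lf$ exists at every $z\in\Omega$ and also holds in $L_2(\mu)$; and $\mathcal Lf\in\mathcal A$ and $P_tf\in\mathcal A$ for all $t\ge0$. Let $\mathbb H_d$ be the space of $d\times d$ complex Hermitian matrices. A function $f:\Omega\to\mathbb H_d$ is called suitable if the real and imaginary parts of all its entries belong to $\mathcal A$. Define $$\Gamma(f,g)=\tfrac12\big[\mathcal L(fg)-f\,\mathcal L(g)-\mathcal L(f)\,g\big],\qquad \Gamma_2(f,g)=\tfrac12\big[\mathcal L\Gamma(f,g)-\Gamma(f,\mathcal Lg)-\Gamma(\mathcal Lf,g)\big],$$ and $\Gamma(f)=\Gamma(f,f)$, $\Gamma_2(f)=\Gamma_2(f,f)$. Write $A\preccurlyeq B$ when $B-A$ is positive semidefinite, $\|\cdot\|$ for the $\ell_2$ operator norm and $\operatorname{tr}$ for the trace; functions of Hermitian matrices are defined by the spectral calculus and bind before the trace. **Theorem (Polynomial moments).** Let $c>0$, and assume the Bakry–Émery criterion: for every suitable $f:\Omega\to\mathbb H_d$, the inequality $\Gamma(f)\preccurlyeq c\,\Gamma_2(f)$ holds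 $\mu$-almost everywhere. Let $f:\Omega\to\mathbb H_d$ be suitable, and let $q=1$ or $q\ge 1.5$. Then $\operatorname{tr}|f-\mathbb E_\mu f|^{2q}$ and $\operatorname{tr}\Gamma(f)^q$ are $\mu$-integrable, and $$\Big[\mathbb E_\mu\operatorname{tr}|f-\mathbb E_\mu f|^{2q}\Big]^{1/(2q)}\le\sqrt{c\,(2q-1)}\,\Big[\mathbb E_\mu\operatorname{tr}\Gamma(f)^q\Big]^{1/(2q)}.$$ If moreover $v_f:=\big\|\,\|\Gamma(f)\|\,\big\|_{L_\infty(\mu)}<+\infty$, then $$\Big[\mathbb E_\mu\operatorname{tr}|f-\mathbb E_\mu f|^{2q}\Big]^{1/(2q)}\le d^{1/(2q)}\sqrt{c\,(2q-1)\,v_f}.$$ -/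

import Mathlib

open MeasureTheory ProbabilityTheory Filter Topology
open scoped ComplexOrder

/-- The transition semigroup of a time-homogeneous Markov process `(Z_t)` with values in `Ω`:
`kernel t z` is the law of `Z_t` conditionally on `Z_0 = z`, and the last field is the
Chapman--Kolmogorov equation. -/
structure MarkovSemigroup (Ω : Type*) [MeasurableSpace Ω] where
  kernel : NNReal → Kernel Ω Ω
  isMarkov : ∀ t, IsMarkovKernel (kernel t)
  kernel_zero : kernel 0 = Kernel.id
  kernel_add : ∀ s t, kernel (s + t) = kernel t ∘ₖ kernel s

/-- The entrywise expectation of a matrix-valued function. -/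
noncomputable def matExpect {Ω : Type*} [MeasurableSpace Ω] {d : ℕ} (ν : Measure Ω)
    (f : Ω → Matrix (Fin d) (Fin d) ℂ) : Matrix (Fin d) (Fin d) ℂ :=
  Matrix.of fun i j => ∫ y, f y i j ∂ν

/-- The `ℓ₂` operator norm of a matrix. -/
noncomputable def specNorm {d : ℕ} (A : Matrix (Fin d) (Fin d) ℂ) : ℝ :=
  ‖Matrix.toEuclideanCLM (n := Fin d) (𝕜 := ℂ) A‖

/-- A Hermitian-matrix-valued function is suitable if the real and imaginary parts of its entries
belong to the algebra `𝒜` of suitable real-valued functions. -/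
structure IsSuitableMat {Ω : Type*} {d : ℕ} (𝒜 : Subalgebra ℝ (Ω → ℝ))
    (f : Ω → Matrix (Fin d) (Fin d) ℂ) : Prop where
  isHermitian : ∀ z, (f z).IsHermitian
  re_mem : ∀ i j, (fun z => (f z i j).re) ∈ 𝒜
  im_mem : ∀ i j, (fun z => (f z i j).im) ∈ 𝒜

namespace MarkovSemigroup

variable {Ω : Type*} [MeasurableSpace Ω]

/-- `(P_t f)(z) = E[f(Z_t) | Z_0 = z]` for real-valued `f`. -/
noncomputable def act (S : MarkovSemigroup Ω) (t : NNReal) (f : Ω → ℝ) : Ω → ℝ :=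
  fun z => ∫ y, f y ∂(S.kernel t z)

/-- `(P_t f)(z) = E[f(Z_t) | Z_0 = z]` for matrix-valued `f`. -/
noncomputable def matAct (S : MarkovSemigroup Ω) {d : ℕ} (t : NNReal)
    (f : Ω → Matrix (Fin d) (Fin d) ℂ) : Ω → Matrix (Fin d) (Fin d) ℂ :=
  fun z => matExpect (S.kernel t z) f

/-- `μ` is a stationary measure. -/
def IsStationary (S : MarkovSemigroup Ω) (μ : Measure Ω) : Prop :=
  ∀ t, Kernel.Invariant (S.kernel t) μ

/-- Each `P_t` is a symmetric operator on `L²(μ)`. -/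
def IsReversible (S : MarkovSemigroup Ω) (μ : Measure Ω) : Prop :=
  ∀ (t : NNReal) (f g : Ω → ℝ), MemLp f 2 μ → MemLp g 2 μ →
    ∫ z, S.act t f z * g z ∂μ = ∫ z, f z * S.act t g z ∂μ

/-- `P_t f → E_μ f` in `L²(μ)` as `t → ∞`. -/
def IsErgodic (S : MarkovSemigroup Ω) (μ : Measure Ω) : Prop :=
  ∀ f : Ω → ℝ, MemLp f 2 μ →
    Tendsto (fun t : NNReal => eLpNorm (fun z => S.act t f z - ∫ y, f y ∂μ) 2 μ) atTop (𝓝 0)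

/-- The infinitesimal generator `(L f)(z) = lim_{t ↓ 0} ((P_t f)(z) - f(z)) / t` on real-valued
functions. -/
noncomputable def generator (S : MarkovSemigroup Ω) (f : Ω → ℝ) : Ω → ℝ :=
  fun z => limUnder (𝓝[>] (0 : NNReal)) fun t => (t : ℝ)⁻¹ • (S.act t f z - f z)

/-- The infinitesimal generator on matrix-valued functions. -/
noncomputable def matGenerator (S : MarkovSemigroup Ω) {d : ℕ}
    (f : Ω → Matrix (Fin d) (Fin d) ℂ) : Ω → Matrix (Fin d) (Fin d) ℂ :=
  fun z => limUnder (𝓝[>] (0 : NNReal)) fun t => (t : ℝ)⁻¹ • (S.matAct t f z - f z)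

/-- `𝒜` is an algebra of suitable real-valued functions (it contains the constants): the
expectations that define `P_t f` exist, the functions are square-integrable (so, `𝒜` being an
algebra, they have all moments), the limit that defines `L f` exists at every point and also in
`L²(μ)`, and `𝒜` is stable under every `P_t` and under `L`. -/
structure IsSuitable (S : MarkovSemigroup Ω) (μ : Measure Ω) (𝒜 : Subalgebra ℝ (Ω → ℝ)) :
    Prop where
  measurable : ∀ f ∈ 𝒜, Measurable f
  integrable : ∀ f ∈ 𝒜, ∀ (t : NNReal) (z : Ω), Integrable f (S.kernel t z)
  memLp : ∀ f ∈ 𝒜, MemLp f 2 μ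
  act_mem : ∀ f ∈ 𝒜, ∀ t : NNReal, S.act t f ∈ 𝒜
  exists_lim : ∀ f ∈ 𝒜, ∀ z : Ω, ∃ l : ℝ,
    Tendsto (fun t : NNReal => (t : ℝ)⁻¹ • (S.act t f z - f z)) (𝓝[>] 0) (𝓝 l)
  tendsto_L2 : ∀ f ∈ 𝒜,
    Tendsto (fun t : NNReal =>
      eLpNorm (fun z => (t : ℝ)⁻¹ • (S.act t f z - f z) - S.generator f z) 2 μ) (𝓝[>] 0) (𝓝 0)
  generator_mem : ∀ f ∈ 𝒜, S.generator f ∈ 𝒜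

/-- The matrix carré du champ `Γ(f, g) = (L(f g) - f L(g) - L(f) g) / 2`. -/
noncomputable def Gamma (S : MarkovSemigroup Ω) {d : ℕ}
    (f g : Ω → Matrix (Fin d) (Fin d) ℂ) : Ω → Matrix (Fin d) (Fin d) ℂ :=
  (1 / 2 : ℝ) • (S.matGenerator (f * g) - f * S.matGenerator g - S.matGenerator f * g)

/-- The iterated matrix carré du champ `Γ₂(f, g) = (L Γ(f, g) - Γ(f, L g) - Γ(L f, g)) / 2`. -/
noncomputable def Gamma₂ (S : MarkovSemigroup Ω) {d : ℕ}
    (f g : Ω → Matrix (Fin d) (Fin d) ℂ) : Ω → Matrix (Fin d) (Fin d) ℂ :=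
  (1 / 2 : ℝ) • (S.matGenerator (S.Gamma f g) - S.Gamma f (S.matGenerator g)
    - S.Gamma (S.matGenerator f) g)

/-- The matrix Bakry--Émery criterion: `Γ(f) ≼ c Γ₂(f)` holds `μ`-almost everywhere, for all
suitable `f` with values in the Hermitian matrices of size `d`. -/
def BakryEmery (S : MarkovSemigroup Ω) (μ : Measure Ω) (𝒜 : Subalgebra ℝ (Ω → ℝ)) (d : ℕ)
    (c : ℝ) : Prop :=
  ∀ f : Ω → Matrix (Fin d) (Fin d) ℂ, IsSuitableMat 𝒜 f →
    ∀ᵐ z ∂μ, (c • S.Gamma₂ f f z - S.Gamma f f z).PosSemidef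

/-- The variance proxy `v_f`, the `L^∞(μ)` norm of `z ↦ ‖Γ(f)(z)‖`. -/
noncomputable def varianceProxy (S : MarkovSemigroup Ω) (μ : Measure Ω) {d : ℕ}
    (f : Ω → Matrix (Fin d) (Fin d) ℂ) : ENNReal :=
  eLpNorm (fun z => specNorm (S.Gamma f f z)) ⊤ μ

end MarkovSemigroup

/-! Subtract the mean, so that `E f = 0`, and put `φ(x) = x |x|^(2q-2)` and `M = E tr |f|^(2q) = E
tr φ(f) f`. By ergodicity `E tr φ(f) P_t f` tends to `0`, so `M` is the integral over `t > 0` of `-E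
tr φ(f) L(P_t f)`.

Reversibility turns each integrand into a Dirichlet form, a limit of expectations of `tr (ΔP_t f ·
Δφ(f))` over the two ends of the stationary pair `(Z_0, Z_t)`. The mean value trace inequality
`re_trace_mul_cfc_sub_le` replaces `Δφ(f)` by `Δf` weighted with `ψ(f)`, where `ψ(x) = (2q-1)
|x|^(2q-2)`. It bounds the integrand by half of `τ E tr ψ(f) Γ(f) + τ⁻¹ E tr ψ(f) Γ(P_t f)` for any
`τ > 0`. The scalar inequality behind it is the trapezoidal bound for `φ`. It rests on convexity of
`|x|^(2q-2)` or on `2q-2 = 0`, whence the restriction on `q`.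

The Bakry–Émery criterion yields the local gradient estimate `Γ(P_t f) ≼ e^(-2t/c) P_t Γ(f)`, tested
against the weight `ψ(f)`. With `τ = e^(-t/c)` both terms decay like `e^(-t/c)`. Young's inequality
for traces bounds `c E tr ψ(f) Γ(f)`, and the same with `P_t Γ(f)`, by `B = K^q/q · E tr Γ(f)^q + (1
- 1/q) M`, where `K = c (2q-1)`. Integration in `t` gives `M ≤ B`, and absorbing `M` gives `M ≤ K^q
E tr Γ(f)^q`.

The analytic difficulty is the gradient estimate. The generator is a limit in `L²` only and is not
bounded there, so `s ↦ P_s Γ(P_{t-s} f)` cannot be differentiated directly. Averaging the test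
functional over a short time interval `[0, ε]` removes the outer generator, since `∫₀^ε P_r L dr =
P_ε - 1`. What remains is a product rule, proved for functionals that are bounded on products of an
`L²` factor with a fixed factor. Letting `ε → 0` restores the original functional. -/

/-- A one-parameter semigroup `P` of linear maps on an algebra, with generator `L`, that contracts
a seminorm `N` whose null space is an ideal. -/
structure IsContractionCalculus {A : Type*} [Ring A] [Algebra ℝ A] (P : ℝ → A →ₗ[ℝ] A)
    (L : A →ₗ[ℝ] A) (N : Seminorm ℝ A) : Prop where
  zero : ∀ x, P 0 x = x
  add : ∀ s t x, 0 ≤ s → 0 ≤ t → P (s + t) x = P s (P t x)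
  contr : ∀ t x, N (P t x) ≤ N x
  gen : ∀ x, Tendsto (fun h : ℝ => N (h⁻¹ • (P h x - x) - L x)) (𝓝[>] 0) (𝓝 0)
  null_mul : ∀ x y, N x = 0 → N (x * y) = 0
  mul_null : ∀ x y, N x = 0 → N (y * x) = 0

/-- The functional `ℓ` is bounded, uniformly along the semigroup, on products with one factor in
the seminorm `N` and the other factor fixed. -/
def IsProductBounded {A : Type*} [Ring A] [Algebra ℝ A] (P : ℝ → A →ₗ[ℝ] A)
    (N : Seminorm ℝ A) (ℓ : A →ₗ[ℝ] ℝ) : Prop :=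
  ∀ y, ∃ C, 0 ≤ C ∧ ∀ u v x, 0 ≤ u → 0 ≤ v →
    |ℓ (P u (x * P v y))| ≤ C * N x ∧ |ℓ (P u (P v y * x))| ≤ C * N x

/-- The carré du champ of a linear map `L`, without the factor `1 / 2`. -/
def dblGamma {A : Type*} [Ring A] [Algebra ℝ A] (L : A →ₗ[ℝ] A) (x y : A) : A :=
  L (x * y) - x * L y - L x * y

/-! ### Generator identities modulo the null ideal of the seminorm. -/

namespace IsContractionCalculus

variable {A : Type*} [Ring A] [Algebra ℝ A] {P : ℝ → A →ₗ[ℝ] A} {L : A →ₗ[ℝ] A}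
  {N : Seminorm ℝ A}

theorem tendsto_zero (H : IsContractionCalculus P L N) (x : A) :
    Tendsto (fun h : ℝ => N (P h x - x)) (𝓝[>] 0) (𝓝 0) := by
  have h1 : Tendsto (fun h : ℝ => h * (N (h⁻¹ • (P h x - x) - L x) + N (L x))) (𝓝[>] 0)
      (𝓝 (0 * (0 + N (L x)))) :=
    (tendsto_id.mono_left nhdsWithin_le_nhds).mul ((H.gen x).add tendsto_const_nhds)
  rw [zero_mul] at h1
  refine tendsto_of_tendsto_of_tendsto_of_le_of_le' tendsto_const_nhds h1
    (Eventually.of_forall fun h => apply_nonneg N _) ?_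
  filter_upwards [self_mem_nhdsWithin] with h (hh : 0 < h)
  have h2 : P h x - x = h • ((h⁻¹ • (P h x - x) - L x) + L x) := by
    rw [sub_add_cancel, smul_smul, mul_inv_cancel₀ hh.ne', one_smul]
  rw [h2, map_smul_eq_mul, Real.norm_of_nonneg hh.le, ← h2]
  exact mul_le_mul_of_nonneg_left (map_add_le_add N _ _) hh.le

/-- `P u` maps the difference quotients of `x` to those of `P u x`. Both families converge, but only
in `N`, so the two limits are identified only up to an `N`-null element. -/
theorem gen_comm (H : IsContractionCalculus P L N) {u : ℝ} (hu : 0 ≤ u) (x : A) :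
    N (L (P u x) - P u (L x)) = 0 := by
  have h1 := (H.gen (P u x)).add (H.gen x)
  rw [add_zero] at h1
  refine le_antisymm (ge_of_tendsto h1 ?_) (apply_nonneg N _)
  filter_upwards [self_mem_nhdsWithin] with h (hh : 0 < h)
  have h3 : P u (h⁻¹ • (P h x - x) - L x) = h⁻¹ • (P h (P u x) - P u x) - P u (L x) := by
    rw [map_sub, map_smul, map_sub, ← H.add _ _ _ hu hh.le, ← H.add _ _ _ hh.le hu, add_comm u h]
  have h2 : L (P u x) - P u (L x) = P u (h⁻¹ • (P h x - x) - L x)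
      - (h⁻¹ • (P h (P u x) - P u x) - L (P u x)) := by
    rw [h3]; abel
  rw [h2]
  refine (map_sub_le_add N _ _).trans ?_
  linarith [H.contr u (h⁻¹ • (P h x - x) - L x)]

/-- Contractivity makes every difference quotient of a null element null. Hence identities modulo
null elements survive an application of `L`, although `L` is not bounded for `N`. -/
theorem null_gen (H : IsContractionCalculus P L N) {x : A} (hx : N x = 0) : N (L x) = 0 := by
  refine le_antisymm (ge_of_tendsto (H.gen x) ?_) (apply_nonneg N _)
  filter_upwards [self_mem_nhdsWithin] with h (hh : 0 < h)
  have h1 : N (h⁻¹ • (P h x - x)) = 0 := by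
    refine le_antisymm ?_ (apply_nonneg N _)
    rw [map_smul_eq_mul]
    have : N (P h x - x) ≤ 0 := by
      linarith [map_sub_le_add N (P h x) x, H.contr h x]
    exact mul_nonpos_of_nonneg_of_nonpos (norm_nonneg _) this
  have h2 : L x = h⁻¹ • (P h x - x) - (h⁻¹ • (P h x - x) - L x) := by abel
  calc N (L x) = N (h⁻¹ • (P h x - x) - (h⁻¹ • (P h x - x) - L x)) := by rw [← h2]
    _ ≤ _ := map_sub_le_add N _ _
    _ = _ := by rw [h1, zero_add]

theorem null_mul_congr (H : IsContractionCalculus P L N) {x x' y y' : A} (hx : N (x - x') = 0)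
    (hy : N (y - y') = 0) : N (x * y - x' * y') = 0 := by
  have : x * y - x' * y' = (x - x') * y + x' * (y - y') := by noncomm_ring
  refine le_antisymm ?_ (apply_nonneg N _)
  rw [this]
  refine (map_add_le_add N _ _).trans ?_
  rw [H.null_mul _ _ hx, H.mul_null _ _ hy, zero_add]

theorem null_sub_congr {x x' y y' : A} (hx : N (x - x') = 0)
    (hy : N (y - y') = 0) : N (x - y - (x' - y')) = 0 := by
  have : x - y - (x' - y') = (x - x') - (y - y') := by abel
  refine le_antisymm ?_ (apply_nonneg N _)
  rw [this]
  refine (map_sub_le_add N _ _).trans ?_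
  rw [hx, hy, zero_add]

theorem null_trans {x y z : A} (hx : N (x - y) = 0) (hy : N (y - z) = 0) : N (x - z) = 0 := by
  refine le_antisymm ?_ (apply_nonneg N _)
  rw [← sub_add_sub_cancel x y z]
  refine (map_add_le_add N _ _).trans ?_
  rw [hx, hy, zero_add]

theorem null_gen_congr (H : IsContractionCalculus P L N) {x y : A} (hx : N (x - y) = 0) :
    N (L x - L y) = 0 := by
  rw [← map_sub]; exact H.null_gen hx

theorem null_refl (x : A) : N (x - x) = 0 := by rw [sub_self, map_zero]

end IsContractionCalculus

theorem tendsto_sub_left {s : ℝ} : Tendsto (fun r : ℝ => s - r) (𝓝[<] s) (𝓝[>] 0) := by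
  refine tendsto_nhdsWithin_iff.2 ⟨?_, ?_⟩
  · have : Tendsto (fun r : ℝ => s - r) (𝓝 s) (𝓝 (s - s)) := (continuous_sub_left s).tendsto s
    rw [sub_self] at this
    exact this.mono_left nhdsWithin_le_nhds
  · filter_upwards [self_mem_nhdsWithin] with r (hr : r < s)
    exact sub_pos.2 hr

theorem tendsto_sub_right {s : ℝ} : Tendsto (fun r : ℝ => r - s) (𝓝[>] s) (𝓝[>] 0) := by
  refine tendsto_nhdsWithin_iff.2 ⟨?_, ?_⟩
  · have : Tendsto (fun r : ℝ => r - s) (𝓝 s) (𝓝 (s - s)) := (continuous_sub_right s).tendsto s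
    rw [sub_self] at this
    exact this.mono_left nhdsWithin_le_nhds
  · filter_upwards [self_mem_nhdsWithin] with r (hr : s < r)
    exact sub_pos.2 hr

/-! ### One-sided calculus along the semigroup. -/

namespace IsProductBounded

variable {A : Type*} [Ring A] [Algebra ℝ A] {P : ℝ → A →ₗ[ℝ] A} {L : A →ₗ[ℝ] A}
  {N : Seminorm ℝ A} {ℓ : A →ₗ[ℝ] ℝ}

theorem exists_bound (hℓ : IsProductBounded P N ℓ) (H : IsContractionCalculus P L N) :
    ∃ C, 0 ≤ C ∧ ∀ x, |ℓ x| ≤ C * N x := by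
  obtain ⟨C, hC, h⟩ := hℓ 1
  refine ⟨C, hC, fun x => ?_⟩
  have := (h 0 0 x le_rfl le_rfl).1
  rwa [H.zero, H.zero, mul_one] at this

theorem congr (hℓ : IsProductBounded P N ℓ) (H : IsContractionCalculus P L N) {x y : A}
    (hxy : N (x - y) = 0) : ℓ x = ℓ y := by
  obtain ⟨C, -, h⟩ := hℓ.exists_bound H
  have := h (x - y)
  rw [hxy, mul_zero, map_sub] at this
  exact sub_eq_zero.1 (abs_nonpos_iff.1 this)

theorem comp (hℓ : IsProductBounded P N ℓ) (H : IsContractionCalculus P L N) {r : ℝ}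
    (hr : 0 ≤ r) : IsProductBounded P N (ℓ ∘ₗ P r) := by
  intro y
  obtain ⟨C, hC, h⟩ := hℓ y
  refine ⟨C, hC, fun u v x hu hv => ?_⟩
  have := h (r + u) v x (by positivity) hv
  simpa only [H.add _ _ _ hr hu, LinearMap.comp_apply] using this

theorem tendsto_of_null (hℓ : IsProductBounded P N ℓ) (H : IsContractionCalculus P L N)
    {α : Type*} {l : Filter α} {x : α → A} (hx : Tendsto (fun a => N (x a)) l (𝓝 0)) :
    Tendsto (fun a => ℓ (x a)) l (𝓝 0) := by
  obtain ⟨C, -, h⟩ := hℓ.exists_bound H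
  refine squeeze_zero_norm (a := fun a => C * N (x a)) (fun a => h _) ?_
  simpa using hx.const_mul C

/-- Factoring `P r = P s P (r - s)` reduces the slope to a difference quotient at time `0`. Only
right derivatives result; with continuity they suffice for the fundamental theorem of calculus and
for comparison arguments. -/
theorem hasDerivWithinAt_semigroup (hℓ : IsProductBounded P N ℓ)
    (H : IsContractionCalculus P L N) (x : A) {s : ℝ} (hs : 0 ≤ s) :
    HasDerivWithinAt (fun r => ℓ (P r x)) (ℓ (P s (L x))) (Set.Ici s) s := by
  rw [← hasDerivWithinAt_Ioi_iff_Ici, hasDerivWithinAt_iff_tendsto_slope' (by simp)]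
  have h1 := (hℓ.comp H hs).tendsto_of_null H ((H.gen x).comp (tendsto_sub_right (s := s)))
  have h2 := h1.add_const (ℓ (P s (L x)))
  rw [zero_add] at h2
  refine h2.congr' ?_
  filter_upwards [self_mem_nhdsWithin] with r (hr : s < r)
  have h3 : P r x = P s (P (r - s) x) := by
    rw [← H.add _ _ _ hs (sub_pos.2 hr).le]; congr 1; ring_nf
  rw [slope_def_field, h3]
  simp only [LinearMap.comp_apply, map_sub, map_smul, smul_eq_mul]
  field_simp
  ring

theorem continuousOn_semigroup (hℓ : IsProductBounded P N ℓ)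
    (H : IsContractionCalculus P L N) (x : A) :
    ContinuousOn (fun r => ℓ (P r x)) (Set.Ici 0) := by
  intro s hs
  have h0 : ContinuousWithinAt (fun r => ℓ (P r x)) (Set.Ici s) s :=
    (hℓ.hasDerivWithinAt_semigroup H x hs).continuousWithinAt
  have h1 : ContinuousWithinAt (fun r => ℓ (P r x)) (Set.Ici 0 ∩ Set.Iio s) s := by
    obtain ⟨C, hC, h⟩ := hℓ.exists_bound H
    rw [ContinuousWithinAt, tendsto_iff_norm_sub_tendsto_zero]
    have h2 : Tendsto (fun r : ℝ => C * N (P (s - r) x - x)) (𝓝[Set.Ici 0 ∩ Set.Iio s] s)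
        (𝓝 0) := by
      have := (((H.tendsto_zero x).comp (tendsto_sub_left (s := s))).const_mul C).mono_left
        (nhdsWithin_mono s (Set.inter_subset_right (s := Set.Ici (0 : ℝ))))
      simpa using this
    refine squeeze_zero' (Eventually.of_forall fun _ => norm_nonneg _) ?_ h2
    filter_upwards [self_mem_nhdsWithin] with r hr
    have hr0 : 0 ≤ r := hr.1
    have hrs : r < s := hr.2
    -- For left continuity the later time is factored through the earlier one, and the contraction
    -- `P r` leaves an error independent of `r` apart from `s - r`.
    have h3 : P s x = P r (P (s - r) x) := by
      rw [← H.add _ _ _ hr0 (sub_pos.2 hrs).le]; congr 1; ring_nf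
    rw [norm_sub_rev, ← map_sub, h3, ← map_sub]
    refine (h _).trans (mul_le_mul_of_nonneg_left (H.contr r _) hC)
  have h2 := h0.union h1
  refine h2.mono fun r hr => ?_
  rcases le_or_gt s r with h | h
  · exact Or.inl h
  · exact Or.inr ⟨hr, h⟩

end IsProductBounded

/-! ### Backward increments and the product rule. -/

namespace IsContractionCalculus

variable {A : Type*} [Ring A] [Algebra ℝ A] {P : ℝ → A →ₗ[ℝ] A} {L : A →ₗ[ℝ] A}
  {N : Seminorm ℝ A}

theorem back_sub (H : IsContractionCalculus P L N) {t s r : ℝ} (hsr : s ≤ r) (hrt : r ≤ t) (x : A) :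
    P (t - r) x - P (t - s) x = - P (t - r) (P (r - s) x - x) := by
  have h3 : P (t - s) x = P (t - r) (P (r - s) x) := by
    rw [← H.add _ _ _ (sub_nonneg.2 hrt) (sub_nonneg.2 hsr)]; congr 1; ring_nf
  rw [h3, map_sub]; abel

theorem back_sub_le (H : IsContractionCalculus P L N) {t s r : ℝ} (hsr : s ≤ r) (hrt : r ≤ t)
    (x : A) : N (P (t - r) x - P (t - s) x) ≤ N (P (r - s) x - x) := by
  rw [H.back_sub hsr hrt, map_neg_eq_map]
  exact H.contr _ _

/-- Everything at time `t - s` factors through the contraction `P (t - r)`. What it acts on involves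
only the forward time `r - s`, where the generator limit is available. -/
theorem back_slope_le (H : IsContractionCalculus P L N) {t s r : ℝ} (hsr : s ≤ r) (hrt : r ≤ t)
    (x : A) : N ((r - s)⁻¹ • (P (t - r) x - P (t - s) x) + P (t - s) (L x))
      ≤ N ((r - s)⁻¹ • (P (r - s) x - x) - L x) + N (P (r - s) (L x) - L x) := by
  have h1 : P (t - s) (L x) = P (t - r) (L x) + P (t - r) (P (r - s) (L x) - L x) := by
    have := H.back_sub hsr hrt (L x)
    rw [sub_eq_iff_eq_add] at this
    rw [this]; abel
  have h2 : (r - s)⁻¹ • (P (t - r) x - P (t - s) x) + P (t - s) (L x)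
      = P (t - r) (P (r - s) (L x) - L x) - P (t - r) ((r - s)⁻¹ • (P (r - s) x - x) - L x) := by
    rw [H.back_sub hsr hrt, h1, map_sub (P (t - r)) ((r - s)⁻¹ • _), map_smul, smul_neg]
    abel
  rw [h2, add_comm (N _)]
  exact (map_sub_le_add N _ _).trans (add_le_add (H.contr _ _) (H.contr _ _))

end IsContractionCalculus

namespace IsProductBounded

variable {A : Type*} [Ring A] [Algebra ℝ A] {P : ℝ → A →ₗ[ℝ] A} {L : A →ₗ[ℝ] A}
  {N : Seminorm ℝ A} {ℓ : A →ₗ[ℝ] ℝ}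

/-- In each error of the product rule one factor is small in `N` and the other is `P v` of a fixed
element. Product boundedness controls exactly such terms, uniformly in `v` and in the outer time
`r`. -/
theorem hasDerivWithinAt_product (hℓ : IsProductBounded P N ℓ)
    (H : IsContractionCalculus P L N) (x y : A) {s t : ℝ} (hs : 0 ≤ s) (hst : s < t) :
    HasDerivWithinAt (fun r => ℓ (P r (P (t - r) x * P (t - r) y)))
      (ℓ (P s (L (P (t - s) x * P (t - s) y) - P (t - s) x * P (t - s) (L y)
        - P (t - s) (L x) * P (t - s) y))) (Set.Ici s) s := by
  rw [← hasDerivWithinAt_Ioi_iff_Ici, hasDerivWithinAt_iff_tendsto_slope' (by simp)]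
  have hts : 0 ≤ t - s := (sub_pos.2 hst).le
  obtain ⟨Cy, hCy, hy⟩ := hℓ y
  obtain ⟨Cx, hCx, hx⟩ := hℓ x
  obtain ⟨Cl, hCl, hl⟩ := hℓ (L x)
  set z := P (t - s) x * P (t - s) y with hz
  set w := P (t - s) (L x) * P (t - s) y + P (t - s) x * P (t - s) (L y) with hw
  have hrt : ∀ᶠ r in 𝓝[>] s, r < t := mem_nhdsWithin_of_mem_nhds (Iio_mem_nhds hst)
  -- `E1` is the outer semigroup on the frozen product `z`. `E2` and `E3` are the backward
  -- difference quotients of the two factors. `E4` corrects for `P (t - r) y` standing where `P (t -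
  -- s) y` should. `E5` is continuity of the outer semigroup on the frozen derivative `w`.
  have E1 : Tendsto (fun r => ℓ (P s ((r - s)⁻¹ • (P (r - s) z - z) - L z))) (𝓝[>] s) (𝓝 0) :=
    (hℓ.comp H hs).tendsto_of_null H ((H.gen z).comp tendsto_sub_right)
  have B : ∀ x, Tendsto (fun r => N ((r - s)⁻¹ • (P (r - s) x - x) - L x)
      + N (P (r - s) (L x) - L x)) (𝓝[>] s) (𝓝 0) := fun x => by
    simpa using ((H.gen x).comp tendsto_sub_right).add
      ((H.tendsto_zero (L x)).comp (tendsto_sub_right (s := s)))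
  have E2 : Tendsto (fun r => ℓ (P r (((r - s)⁻¹ • (P (t - r) x - P (t - s) x)
      + P (t - s) (L x)) * P (t - r) y))) (𝓝[>] s) (𝓝 0) := by
    refine squeeze_zero_norm' ?_ (by simpa using (B x).const_mul Cy)
    filter_upwards [self_mem_nhdsWithin, hrt] with r (hr : s < r) hr'
    exact (hy r (t - r) _ (hs.trans hr.le) (sub_pos.2 hr').le).1.trans
      (mul_le_mul_of_nonneg_left (H.back_slope_le hr.le hr'.le x) hCy)
  have E3 : Tendsto (fun r => ℓ (P r (P (t - s) x * ((r - s)⁻¹ • (P (t - r) y - P (t - s) y)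
      + P (t - s) (L y))))) (𝓝[>] s) (𝓝 0) := by
    refine squeeze_zero_norm' ?_ (by simpa using (B y).const_mul Cx)
    filter_upwards [self_mem_nhdsWithin, hrt] with r (hr : s < r) hr'
    exact (hx r (t - s) _ (hs.trans hr.le) hts).2.trans
      (mul_le_mul_of_nonneg_left (H.back_slope_le hr.le hr'.le y) hCx)
  have E4 : Tendsto (fun r => ℓ (P r (P (t - s) (L x) * (P (t - r) y - P (t - s) y))))
      (𝓝[>] s) (𝓝 0) := by
    refine squeeze_zero_norm' ?_ (by
      simpa using ((H.tendsto_zero y).comp (tendsto_sub_right (s := s))).const_mul Cl)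
    filter_upwards [self_mem_nhdsWithin, hrt] with r (hr : s < r) hr'
    exact (hl r (t - s) _ (hs.trans hr.le) hts).2.trans
      (mul_le_mul_of_nonneg_left (H.back_sub_le hr.le hr'.le y) hCl)
  have E5 : Tendsto (fun r => ℓ (P r w)) (𝓝[>] s) (𝓝 (ℓ (P s w))) :=
    (hℓ.hasDerivWithinAt_semigroup H w hs).continuousWithinAt.mono Set.Ioi_subset_Ici_self
  have E := ((((E1.add_const (ℓ (P s (L z)))).add E2).add E3).sub E4).sub E5
  have hlim : 0 + ℓ (P s (L z)) + 0 + 0 - 0 - ℓ (P s w) = ℓ (P s (L z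
      - P (t - s) x * P (t - s) (L y) - P (t - s) (L x) * P (t - s) y)) := by
    rw [hw]; simp only [map_sub, map_add]; ring
  rw [hlim] at E
  refine E.congr' ?_
  filter_upwards [self_mem_nhdsWithin, hrt] with r (hr : s < r) hr'
  have h3 : P r z = P s (P (r - s) z) := by
    rw [← H.add _ _ _ hs (sub_pos.2 hr).le]; congr 1; ring_nf
  have hne : r - s ≠ 0 := (sub_pos.2 hr).ne'
  have h4 : (r - s)⁻¹ • (P (t - r) x * P (t - r) y - z) = ((r - s)⁻¹ • (P (t - r) x - P (t - s) x)
      + P (t - s) (L x)) * P (t - r) y + P (t - s) x * ((r - s)⁻¹ • (P (t - r) y - P (t - s) y)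
      + P (t - s) (L y)) - P (t - s) (L x) * (P (t - r) y - P (t - s) y) - w := by
    rw [hw, hz]
    simp only [mul_add, add_mul, mul_sub, sub_mul, smul_mul_assoc, mul_smul_comm, smul_sub]
    abel
  have h5 : (r - s)⁻¹ * (ℓ (P r (P (t - r) x * P (t - r) y)) - ℓ (P r z))
      = ℓ (P r ((r - s)⁻¹ • (P (t - r) x * P (t - r) y - z))) := by
    simp only [map_smul, map_sub, smul_eq_mul]
  have h6 : (r - s)⁻¹ * (ℓ (P r z) - ℓ (P s z)) = ℓ (P s ((r - s)⁻¹ • (P (r - s) z - z) - L z))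
      + ℓ (P s (L z)) := by
    simp only [map_smul, map_sub, smul_eq_mul, h3]; ring
  have h7 : slope (fun r => ℓ (P r (P (t - r) x * P (t - r) y))) s r
      = (r - s)⁻¹ * (ℓ (P r (P (t - r) x * P (t - r) y)) - ℓ (P r z))
        + (r - s)⁻¹ * (ℓ (P r z) - ℓ (P s z)) := by
    rw [slope_def_field, hz]; ring
  rw [h7, h5, h6, h4]
  simp only [map_add, map_sub]
  ring

theorem continuousOn_product (hℓ : IsProductBounded P N ℓ)
    (H : IsContractionCalculus P L N) (x y : A) (t : ℝ) :
    ContinuousOn (fun r => ℓ (P r (P (t - r) x * P (t - r) y))) (Set.Icc 0 t) := by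
  intro s hs
  have hts : 0 ≤ t - s := sub_nonneg.2 hs.2
  have h0 : ContinuousWithinAt (fun r => ℓ (P r (P (t - r) x * P (t - r) y)))
      (Set.Icc s t) s := by
    rcases hs.2.eq_or_lt with rfl | h
    · rw [Set.Icc_self]; exact continuousWithinAt_singleton
    · exact (hℓ.hasDerivWithinAt_product H x y hs.1 h).continuousWithinAt.mono Set.Icc_subset_Ici_self
  have h1 : ContinuousWithinAt (fun r => ℓ (P r (P (t - r) x * P (t - r) y)))
      (Set.Ici 0 ∩ Set.Iio s) s := by
    obtain ⟨C, hC, h⟩ := hℓ 1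
    obtain ⟨Cy, hCy, hy⟩ := hℓ y
    obtain ⟨Cx, hCx, hx⟩ := hℓ x
    set z := P (t - s) x * P (t - s) y with hz
    rw [ContinuousWithinAt, tendsto_iff_norm_sub_tendsto_zero]
    have h2 : Tendsto (fun r : ℝ => C * N (P (s - r) z - z) + (Cy * N (P (s - r) x - x)
        + Cx * N (P (s - r) y - y))) (𝓝[Set.Ici 0 ∩ Set.Iio s] s) (𝓝 0) := by
      have e (x : A) := (((H.tendsto_zero x).comp (tendsto_sub_left (s := s)))).mono_left
        (nhdsWithin_mono s (Set.inter_subset_right (s := Set.Ici (0 : ℝ))))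
      simpa using ((e z).const_mul C).add (((e x).const_mul Cy).add ((e y).const_mul Cx))
    refine squeeze_zero' (Eventually.of_forall fun _ => norm_nonneg _) ?_ h2
    filter_upwards [self_mem_nhdsWithin] with r hr
    have hr0 : 0 ≤ r := hr.1
    have hrs : r < s := hr.2
    have h3 : P s z = P r (P (s - r) z) := by
      rw [← H.add _ _ _ hr0 (sub_pos.2 hrs).le]; congr 1; ring_nf
    -- The factor `P 0 1 = 1` brings the first term into the shape that product boundedness accepts.
    have h4 : P s z - P r (P (t - r) x * P (t - r) y) = P r ((P (s - r) z - z) * P 0 1)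
        + (P r ((P (t - s) x - P (t - r) x) * P (t - s) y)
        + P r (P (t - r) x * (P (t - s) y - P (t - r) y))) := by
      rw [h3, H.zero, mul_one, ← map_add, ← map_add, ← map_sub, hz]
      congr 1
      simp only [mul_sub, sub_mul]
      abel
    rw [norm_sub_rev, ← map_sub, h4, map_add, map_add]
    refine (norm_add_le _ _).trans (add_le_add (h r 0 _ hr0 le_rfl).1
      ((norm_add_le _ _).trans (add_le_add ?_ ?_)))
    · exact (hy r (t - s) _ hr0 hts).1.trans
        (mul_le_mul_of_nonneg_left (H.back_sub_le hrs.le hs.2 x) hCy)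
    · exact (hx r (t - r) _ hr0 (by linarith)).2.trans
        (mul_le_mul_of_nonneg_left (H.back_sub_le hrs.le hs.2 y) hCx)
  have h2 := h0.union h1
  refine h2.mono fun r hr => ?_
  rcases le_or_gt s r with h | h
  · exact Or.inl ⟨h, hr.2⟩
  · exact Or.inr ⟨hr.1, h⟩

end IsProductBounded

/-! ### Time averages and the local gradient estimate. -/

namespace IsProductBounded

variable {A : Type*} [Ring A] [Algebra ℝ A] {P : ℝ → A →ₗ[ℝ] A} {L : A →ₗ[ℝ] A}
  {N : Seminorm ℝ A} {ℓ : A →ₗ[ℝ] ℝ}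

theorem intervalIntegrable (hℓ : IsProductBounded P N ℓ) (H : IsContractionCalculus P L N)
    {a b : ℝ} (ha : 0 ≤ a) (hb : 0 ≤ b) (x : A) :
    IntervalIntegrable (fun r => ℓ (P r x)) volume a b :=
  ((hℓ.continuousOn_semigroup H x).mono fun _ hr => le_trans (le_min ha hb) hr.1).intervalIntegrable

/-- The functional `x ↦ ∫₀^ε ℓ (P_r x) dr`. -/
noncomputable def avg (hℓ : IsProductBounded P N ℓ) (H : IsContractionCalculus P L N)
    (ε : ℝ) (hε : 0 ≤ ε) : A →ₗ[ℝ] ℝ where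
  toFun x := ∫ r in (0 : ℝ)..ε, ℓ (P r x)
  map_add' x y := by
    simp only [map_add]
    exact intervalIntegral.integral_add (hℓ.intervalIntegrable H le_rfl hε x)
      (hℓ.intervalIntegrable H le_rfl hε y)
  map_smul' a x := by
    simp only [map_smul, smul_eq_mul, RingHom.id_apply, intervalIntegral.integral_const_mul]

theorem avg_apply (hℓ : IsProductBounded P N ℓ) (H : IsContractionCalculus P L N)
    (ε : ℝ) (hε : 0 ≤ ε) (x : A) : hℓ.avg H ε hε x = ∫ r in (0 : ℝ)..ε, ℓ (P r x) := rfl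

theorem isProductBounded_avg (hℓ : IsProductBounded P N ℓ) (H : IsContractionCalculus P L N)
    (ε : ℝ) (hε : 0 ≤ ε) : IsProductBounded P N (hℓ.avg H ε hε) := by
  intro y
  obtain ⟨C, hC, h⟩ := hℓ y
  have key : ∀ z, ∀ K, (∀ r, 0 ≤ r → |ℓ (P r z)| ≤ K) → |hℓ.avg H ε hε z| ≤ K * ε := by
    intro z K hK
    have := intervalIntegral.norm_integral_le_of_norm_le_const (a := 0) (b := ε)
      (f := fun r => ℓ (P r z)) (C := K) (fun r hr => by
        rw [Set.uIoc_of_le hε] at hr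
        exact hK r hr.1.le)
    rwa [sub_zero, abs_of_nonneg hε] at this
  refine ⟨C * ε, by positivity, fun u v x hu hv => ⟨?_, ?_⟩⟩
  · rw [mul_right_comm]
    refine key _ _ fun r hr => ?_
    rw [← H.add _ _ _ hr hu]
    exact (h (r + u) v x (by positivity) hv).1
  · rw [mul_right_comm]
    refine key _ _ fun r hr => ?_
    rw [← H.add _ _ _ hr hu]
    exact (h (r + u) v x (by positivity) hv).2

/-- The fundamental theorem of calculus: averaging in time trades the unbounded `L` for two values
of the semigroup. -/
theorem avg_gen (hℓ : IsProductBounded P N ℓ) (H : IsContractionCalculus P L N)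
    (ε : ℝ) (hε : 0 ≤ ε) (x : A) : hℓ.avg H ε hε (L x) = ℓ (P ε x) - ℓ x := by
  have := intervalIntegral.integral_eq_sub_of_hasDeriv_right (a := 0) (b := ε)
    (f := fun r => ℓ (P r x)) (f' := fun r => ℓ (P r (L x)))
    ((hℓ.continuousOn_semigroup H x).mono fun r hr => by
      rw [Set.uIcc_of_le hε] at hr; exact hr.1)
    (fun r hr => by
      rw [min_eq_left hε] at hr
      exact (hℓ.hasDerivWithinAt_semigroup H x hr.1.le).mono Set.Ioi_subset_Ici_self)
    (hℓ.intervalIntegrable H le_rfl hε _)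
  rw [avg_apply, this, H.zero]

theorem nonneg_of_avg_nonneg (hℓ : IsProductBounded P N ℓ) (H : IsContractionCalculus P L N)
    {x : A} (h : ∀ ε (hε : 0 ≤ ε), 0 ≤ hℓ.avg H ε hε x) : 0 ≤ ℓ x := by
  by_contra! hx
  have hc := (hℓ.continuousOn_semigroup H x) 0 (Set.mem_Ici.2 le_rfl)
  have h0 : ∀ᶠ r in 𝓝[≥] (0 : ℝ), ℓ (P r x) < ℓ x / 2 := by
    refine hc.eventually_lt_const ?_
    simp only [H.zero]; linarith
  obtain ⟨δ, hδ, hsub⟩ := mem_nhdsGE_iff_exists_Icc_subset.1 h0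
  have hδ' : (0 : ℝ) ≤ δ := le_of_lt hδ
  have h1 : hℓ.avg H δ hδ' x ≤ ∫ _ in (0 : ℝ)..δ, ℓ x / 2 := by
    rw [avg_apply]
    refine intervalIntegral.integral_mono_on hδ' (hℓ.intervalIntegrable H le_rfl hδ' x)
      (by simp) fun r hr => ?_
    have h3 : ℓ (P r x) < ℓ x / 2 := hsub hr
    exact h3.le
  rw [intervalIntegral.integral_const, smul_eq_mul, sub_zero] at h1
  have h2 : δ * (ℓ x / 2) < 0 := mul_neg_of_pos_of_neg hδ (by linarith)
  linarith [h δ hδ']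

/-- The iterated carré du champ of a linear map, without the factor `1 / 4`. -/
def _root_.quadGamma₂ (L : A →ₗ[ℝ] A) (x : A) : A :=
  L (dblGamma L x x) - dblGamma L x (L x) - dblGamma L (L x) x

/-- Interpolate by `k s = m (P_s Γ(P_{t-s} x))`, up to the factor `2`. Its derivative is an iterated
carré du champ, and since `dblGamma` is `2Γ` and `quadGamma₂` is `4Γ₂` for the concrete generator,
`hBE` says `k' ≥ (2/c) k`. The averaged functional `m` is what makes `k` differentiable. -/
theorem avg_dblGamma_le (hℓ : IsProductBounded P N ℓ) (H : IsContractionCalculus P L N)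
    {t c : ℝ} (ht : 0 ≤ t) (hc : 0 < c) (x : A)
    (hBE : ∀ r v, 0 ≤ r → 0 ≤ v →
      0 ≤ ℓ (P r (c • quadGamma₂ L (P v x) - (2 : ℝ) • dblGamma L (P v x) (P v x))))
    (ε : ℝ) (hε : 0 ≤ ε) :
    hℓ.avg H ε hε (dblGamma L (P t x) (P t x))
      ≤ Real.exp (-(2 * t / c)) * hℓ.avg H ε hε (P t (dblGamma L x x)) := by
  set m := hℓ.avg H ε hε with hm_def
  have hm : IsProductBounded P N m := hℓ.isProductBounded_avg H ε hε
  have hℓε : IsProductBounded P N (ℓ ∘ₗ P ε) := hℓ.comp H hε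
  have mgen : ∀ s z, 0 ≤ s → m (P s (L z)) = ℓ (P ε (P s z)) - ℓ (P s z) := fun s z hs => by
    rw [← hℓ.avg_gen H ε hε]
    refine hm.congr H ?_
    rw [← map_neg_eq_map N, neg_sub]
    exact H.gen_comm hs z
  -- The outer generator in `m (P s (L (⋯)))` is written through `avg_gen` as a difference of values
  -- of `ℓ`, so every term falls under the product rule.
  set k : ℝ → ℝ := fun s => (ℓ ∘ₗ P ε) (P s (P (t - s) x * P (t - s) x))
    - ℓ (P s (P (t - s) x * P (t - s) x)) - m (P s (P (t - s) x * P (t - s) (L x)))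
    - m (P s (P (t - s) (L x) * P (t - s) x)) with hk_def
  have hk : ∀ s, 0 ≤ s → s ≤ t → k s = m (P s (dblGamma L (P (t - s) x) (P (t - s) x))) := by
    intro s hs hst
    have hv : 0 ≤ t - s := sub_nonneg.2 hst
    have e := H.gen_comm hv x
    have e' : N (P (t - s) (L x) - L (P (t - s) x)) = 0 := by
      rwa [← map_neg_eq_map N, neg_sub]
    rw [hk_def]
    simp only [LinearMap.comp_apply]
    rw [← mgen s _ hs, ← map_sub, ← map_sub, ← map_sub, ← map_sub]
    exact (hm.comp H hs).congr H (IsContractionCalculus.null_sub_congr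
      (IsContractionCalculus.null_sub_congr (IsContractionCalculus.null_refl _)
        (H.null_mul_congr (IsContractionCalculus.null_refl _) e'))
      (H.null_mul_congr e' (IsContractionCalculus.null_refl _)))
  have hkc : ContinuousOn k (Set.Icc 0 t) :=
    (((hℓε.continuousOn_product H x x t).sub (hℓ.continuousOn_product H x x t)).sub
      (hm.continuousOn_product H x (L x) t)).sub (hm.continuousOn_product H (L x) x t)
  set k' : ℝ → ℝ := fun s => m (P s (quadGamma₂ L (P (t - s) x))) with hk'_def
  have hkd : ∀ s ∈ Set.Ico 0 t, HasDerivWithinAt k (k' s) (Set.Ici s) s := by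
    intro s hs
    have hs0 := hs.1
    have hv : 0 ≤ t - s := sub_nonneg.2 hs.2.le
    have D := (((hℓε.hasDerivWithinAt_product H x x hs.1 hs.2).sub
      (hℓ.hasDerivWithinAt_product H x x hs.1 hs.2)).sub
      (hm.hasDerivWithinAt_product H x (L x) hs.1 hs.2)).sub
      (hm.hasDerivWithinAt_product H (L x) x hs.1 hs.2)
    refine D.congr_deriv ?_
    -- The product rule produces `P (t - s) (L x)` where the carré du champ has `L (P (t - s) x)`;
    -- they are exchanged modulo null elements, which the functionals do not see.
    have r0 : ∀ y : A, N (y - y) = 0 := IsContractionCalculus.null_refl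
    have e : ∀ y, N (P (t - s) (L y) - L (P (t - s) y)) = 0 := fun y => by
      rw [← map_neg_eq_map N, neg_sub]; exact H.gen_comm hv y
    have e2 : N (P (t - s) (L (L x)) - L (L (P (t - s) x))) = 0 :=
      IsContractionCalculus.null_trans (e (L x)) (H.null_gen_congr (e x))
    have q1 : N (L (P (t - s) x * P (t - s) x) - P (t - s) x * P (t - s) (L x)
        - P (t - s) (L x) * P (t - s) x - dblGamma L (P (t - s) x) (P (t - s) x)) = 0 :=
      IsContractionCalculus.null_sub_congr (IsContractionCalculus.null_sub_congr (r0 _)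
        (H.null_mul_congr (r0 _) (e x))) (H.null_mul_congr (e x) (r0 _))
    have q2 : N (L (P (t - s) x * P (t - s) (L x)) - P (t - s) x * P (t - s) (L (L x))
        - P (t - s) (L x) * P (t - s) (L x) - dblGamma L (P (t - s) x) (L (P (t - s) x))) = 0 :=
      IsContractionCalculus.null_sub_congr (IsContractionCalculus.null_sub_congr
        (H.null_gen_congr (H.null_mul_congr (r0 _) (e x)))
        (H.null_mul_congr (r0 _) e2)) (H.null_mul_congr (e x) (e x))
    have q3 : N (L (P (t - s) (L x) * P (t - s) x) - P (t - s) (L x) * P (t - s) (L x)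
        - P (t - s) (L (L x)) * P (t - s) x - dblGamma L (L (P (t - s) x)) (P (t - s) x)) = 0 :=
      IsContractionCalculus.null_sub_congr (IsContractionCalculus.null_sub_congr
        (H.null_gen_congr (H.null_mul_congr (e x) (r0 _)))
        (H.null_mul_congr (e x) (e x))) (H.null_mul_congr e2 (r0 _))
    have p1 := (hℓε.comp H hs0).congr H q1
    have p1' := (hℓ.comp H hs0).congr H q1
    have p2 := (hm.comp H hs0).congr H q2
    have p3 := (hm.comp H hs0).congr H q3
    simp only [LinearMap.comp_apply] at p1 p1' p2 p3 ⊢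
    rw [p1, p1', p2, p3, ← mgen s _ hs0, hk'_def]
    simp only [quadGamma₂, map_sub]
  have hineq : ∀ s ∈ Set.Ico 0 t, 2 / c * k s ≤ k' s := by
    intro s hs
    have hv : 0 ≤ t - s := sub_nonneg.2 hs.2.le
    have h0 : 0 ≤ m (P s (c • quadGamma₂ L (P (t - s) x)
        - (2 : ℝ) • dblGamma L (P (t - s) x) (P (t - s) x))) := by
      rw [hm_def, avg_apply]
      refine intervalIntegral.integral_nonneg hε fun r hr => ?_
      rw [← H.add _ _ _ hr.1 hs.1]
      exact hBE _ _ (add_nonneg hr.1 hs.1) hv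
    rw [hk s hs.1 hs.2.le, hk'_def]
    simp only [map_sub, map_smul, smul_eq_mul] at h0 ⊢
    rw [div_mul_eq_mul_div, div_le_iff₀ hc]
    linarith
  have hexp : ∀ s : ℝ, HasDerivAt (fun s : ℝ => -Real.exp (-(2 * s / c)))
      (2 / c * Real.exp (-(2 * s / c))) s := fun s => by
    have h1 : HasDerivAt (fun s : ℝ => -(2 * s / c)) (-(2 * 1 / c)) s :=
      (((hasDerivAt_id s).const_mul 2).div_const c).neg
    exact h1.exp.neg.congr_deriv (by ring)
  -- Grönwall: `e^(-2s/c) k s` is nondecreasing, stated for its negative as a comparison with the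
  -- constant `-k 0`.
  have hmono := image_le_of_deriv_right_le_deriv_boundary (a := 0) (b := t)
    (f := fun s => -Real.exp (-(2 * s / c)) * k s)
    (f' := fun s => 2 / c * Real.exp (-(2 * s / c)) * k s + -Real.exp (-(2 * s / c)) * k' s)
    (B := fun _ => -k 0) (B' := fun _ => 0)
    ((Continuous.continuousOn (by fun_prop)).mul hkc)
    (fun s hs => (hexp s).hasDerivWithinAt.mul (hkd s hs))
    (by simp) continuousOn_const (fun s _ => hasDerivWithinAt_const _ _ _)
    (fun s hs => by
      have := mul_le_mul_of_nonneg_left (hineq s hs) (Real.exp_pos (-(2 * s / c))).le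
      linarith) (Set.right_mem_Icc.2 ht)
  have h0 := hk 0 le_rfl ht
  have h1 := hk t ht le_rfl
  rw [sub_zero, H.zero] at h0
  rw [sub_self, H.zero] at h1
  rw [← h0, ← h1]
  have hmono' : -Real.exp (-(2 * t / c)) * k t ≤ -k 0 := hmono
  linarith

/-- The gradient estimate `ℓ (Γ (P_t x)) ≤ e^{-2t/c} ℓ (P_t Γ(x))` under a local Bakry--Émery
criterion. -/
theorem dblGamma_semigroup_le (hℓ : IsProductBounded P N ℓ) (H : IsContractionCalculus P L N)
    {t c : ℝ} (ht : 0 ≤ t) (hc : 0 < c) (x : A)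
    (hBE : ∀ r v, 0 ≤ r → 0 ≤ v →
      0 ≤ ℓ (P r (c • quadGamma₂ L (P v x) - (2 : ℝ) • dblGamma L (P v x) (P v x)))) :
    ℓ (dblGamma L (P t x) (P t x)) ≤ Real.exp (-(2 * t / c)) * ℓ (P t (dblGamma L x x)) := by
  have := hℓ.nonneg_of_avg_nonneg H
    (x := Real.exp (-(2 * t / c)) • P t (dblGamma L x x) - dblGamma L (P t x) (P t x))
    fun ε hε => by
      have := hℓ.avg_dblGamma_le H ht hc x hBE ε hε
      rw [map_sub, map_smul, smul_eq_mul]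
      linarith
  rw [map_sub, map_smul, smul_eq_mul] at this
  linarith

/-- The difference quotients that define the carré du champ converge under `ℓ`. -/
theorem tendsto_dblGamma (hℓ : IsProductBounded P N ℓ) (H : IsContractionCalculus P L N) (x : A) :
    Tendsto (fun h : ℝ => h⁻¹ * ℓ (P h (x * x) - x * P h x - P h x * x + x * x)) (𝓝[>] 0)
      (𝓝 (ℓ (dblGamma L x x))) := by
  obtain ⟨C, hC, hx⟩ := hℓ x
  have e1 := hℓ.tendsto_of_null H (H.gen (x * x))
  have e2 : Tendsto (fun h : ℝ => ℓ (x * (h⁻¹ • (P h x - x) - L x))) (𝓝[>] 0) (𝓝 0) := by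
    refine squeeze_zero_norm (fun h => ?_) (by simpa using (H.gen x).const_mul C)
    have := (hx 0 0 (h⁻¹ • (P h x - x) - L x) le_rfl le_rfl).2
    rwa [H.zero, H.zero] at this
  have e3 : Tendsto (fun h : ℝ => ℓ ((h⁻¹ • (P h x - x) - L x) * x)) (𝓝[>] 0) (𝓝 0) := by
    refine squeeze_zero_norm (fun h => ?_) (by simpa using (H.gen x).const_mul C)
    have := (hx 0 0 (h⁻¹ • (P h x - x) - L x) le_rfl le_rfl).1
    rwa [H.zero, H.zero] at this
  have e := ((e1.sub e2).sub e3).add_const (ℓ (dblGamma L x x))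
  rw [sub_zero, sub_zero, zero_add] at e
  refine e.congr fun h => ?_
  have e4 (y : A) : h⁻¹ * ℓ y = ℓ (h⁻¹ • y) := by rw [map_smul, smul_eq_mul]
  rw [e4, ← map_sub, ← map_sub, ← map_add]
  congr 1
  simp only [dblGamma, mul_sub, sub_mul, smul_sub, smul_add, mul_smul_comm, smul_mul_assoc]
  abel

end IsProductBounded

/-! ### Trace inequalities in two eigenbases. -/

section TwoBases

variable {n : Type*} [Fintype n] [DecidableEq n] {A B : Matrix n n ℂ}

theorem Matrix.IsHermitian.cfc_eq_mul (hA : A.IsHermitian) (φ : ℝ → ℝ) :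
    cfc φ A = (hA.eigenvectorUnitary : Matrix n n ℂ)
      * Matrix.diagonal (fun i => ((φ (hA.eigenvalues i) : ℝ) : ℂ))
      * star (hA.eigenvectorUnitary : Matrix n n ℂ) := by
  rw [hA.cfc_eq, Matrix.IsHermitian.cfc, Unitary.conjStarAlgAut_apply]
  rfl

/-- The entries of `C` with respect to the eigenbases of two Hermitian matrices. -/
noncomputable def eigenEntry (hA : A.IsHermitian) (hB : B.IsHermitian) (C : Matrix n n ℂ)
    (j i : n) : ℂ :=
  (star (hB.eigenvectorUnitary : Matrix n n ℂ) * C * (hA.eigenvectorUnitary : Matrix n n ℂ)) j i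

theorem Matrix.IsHermitian.unitary_mul_star (hA : A.IsHermitian) :
    (hA.eigenvectorUnitary : Matrix n n ℂ) * star (hA.eigenvectorUnitary : Matrix n n ℂ) = 1 :=
  Unitary.mul_star_self_of_mem hA.eigenvectorUnitary.2

theorem Matrix.IsHermitian.star_mul_unitary (hA : A.IsHermitian) :
    star (hA.eigenvectorUnitary : Matrix n n ℂ) * (hA.eigenvectorUnitary : Matrix n n ℂ) = 1 :=
  Unitary.star_mul_self_of_mem hA.eigenvectorUnitary.2

theorem trace_mul_diagonal_mul (X Y : Matrix n n ℂ) (v : n → ℂ) :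
    (X * Matrix.diagonal v * Y).trace = ∑ j, ∑ i, v i * (X j i * Y i j) := by
  simp only [Matrix.trace, Matrix.diag, Matrix.mul_apply (M := X * _), Matrix.mul_diagonal]
  exact Finset.sum_congr rfl fun j _ => Finset.sum_congr rfl fun i _ => by ring

theorem star_mul_eigen_apply (hA : A.IsHermitian) (hB : B.IsHermitian) (i j : n) :
    (star (hA.eigenvectorUnitary : Matrix n n ℂ) * (hB.eigenvectorUnitary : Matrix n n ℂ)) i j
      = star (eigenEntry hA hB 1 j i) := by
  rw [eigenEntry, mul_one, ← Matrix.star_apply, star_mul, star_star]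

/-- Rows are expanded in the eigenbasis of `B` and columns in that of `A`. Functions of `A` and of
`B` then act as scalar multipliers on one common array, although `A` and `B` need not commute. -/
theorem trace_mul_cfc_left (hA : A.IsHermitian) (hB : B.IsHermitian) (C : Matrix n n ℂ)
    (φ : ℝ → ℝ) :
    (C * cfc φ A).trace = ∑ j, ∑ i, (φ (hA.eigenvalues i) : ℂ) *
      (eigenEntry hA hB C j i * star (eigenEntry hA hB 1 j i)) := by
  have h : (C * cfc φ A).trace = (star (hB.eigenvectorUnitary : Matrix n n ℂ) * C
      * (hA.eigenvectorUnitary : Matrix n n ℂ)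
      * Matrix.diagonal (fun i => ((φ (hA.eigenvalues i) : ℝ) : ℂ))
      * (star (hA.eigenvectorUnitary : Matrix n n ℂ)
        * (hB.eigenvectorUnitary : Matrix n n ℂ))).trace := by
    conv_rhs => rw [← Matrix.mul_assoc, Matrix.trace_mul_comm]
    simp only [← Matrix.mul_assoc]
    rw [hB.unitary_mul_star, Matrix.one_mul, hA.cfc_eq_mul]
    simp only [← Matrix.mul_assoc]
  rw [h, trace_mul_diagonal_mul]
  simp only [star_mul_eigen_apply hA hB]
  rfl

theorem trace_mul_diagonal_mul' (X Y : Matrix n n ℂ) (v : n → ℂ) :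
    (X * Y * Matrix.diagonal v).trace = ∑ j, ∑ i, v j * (X j i * Y i j) := by
  simp only [Matrix.trace, Matrix.diag, Matrix.mul_diagonal]
  simp only [Matrix.mul_apply, Finset.sum_mul]
  exact Finset.sum_congr rfl fun j _ => Finset.sum_congr rfl fun i _ => by ring

theorem trace_mul_cfc_right (hA : A.IsHermitian) (hB : B.IsHermitian) (C : Matrix n n ℂ)
    (φ : ℝ → ℝ) :
    (C * cfc φ B).trace = ∑ j, ∑ i, (φ (hB.eigenvalues j) : ℂ) *
      (eigenEntry hA hB C j i * star (eigenEntry hA hB 1 j i)) := by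
  have h : (C * cfc φ B).trace = (star (hB.eigenvectorUnitary : Matrix n n ℂ) * C
      * (hA.eigenvectorUnitary : Matrix n n ℂ)
      * (star (hA.eigenvectorUnitary : Matrix n n ℂ)
        * (hB.eigenvectorUnitary : Matrix n n ℂ))
      * Matrix.diagonal (fun i => ((φ (hB.eigenvalues i) : ℝ) : ℂ))).trace := by
    simp only [Matrix.mul_assoc]
    rw [Matrix.trace_mul_comm (star (hB.eigenvectorUnitary : Matrix n n ℂ)),
      ← Matrix.mul_assoc (hA.eigenvectorUnitary : Matrix n n ℂ), hA.unitary_mul_star,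
      Matrix.one_mul, hB.cfc_eq_mul]
    simp only [Matrix.mul_assoc]
  rw [h, trace_mul_diagonal_mul']
  simp only [star_mul_eigen_apply hA hB]
  rfl

theorem eigenEntry_cfc_right (hA : A.IsHermitian) (hB : B.IsHermitian) (φ : ℝ → ℝ) (j i : n) :
    eigenEntry hA hB (cfc φ B) j i = (φ (hB.eigenvalues j) : ℂ) * eigenEntry hA hB 1 j i := by
  rw [eigenEntry, eigenEntry, hB.cfc_eq_mul, Matrix.mul_one]
  simp only [← Matrix.mul_assoc]
  rw [hB.star_mul_unitary, Matrix.one_mul, Matrix.mul_assoc, Matrix.diagonal_mul]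

theorem eigenEntry_cfc_left (hA : A.IsHermitian) (hB : B.IsHermitian) (φ : ℝ → ℝ) (j i : n) :
    eigenEntry hA hB (cfc φ A) j i = (φ (hA.eigenvalues i) : ℂ) * eigenEntry hA hB 1 j i := by
  rw [eigenEntry, eigenEntry, hA.cfc_eq_mul, Matrix.mul_one]
  simp only [Matrix.mul_assoc]
  rw [hA.star_mul_unitary, Matrix.mul_one, ← Matrix.mul_assoc, Matrix.mul_diagonal, mul_comm]

/-- In the mixed bases a difference of matrices becomes a difference of eigenvalues times the
overlap of eigenvectors. This lets a scalar bound on `φ a - φ b` by `a - b` pass to traces. -/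
theorem eigenEntry_sub (hA : A.IsHermitian) (hB : B.IsHermitian) (j i : n) :
    eigenEntry hA hB (A - B) j i
      = ((hA.eigenvalues i - hB.eigenvalues j : ℝ) : ℂ) * eigenEntry hA hB 1 j i := by
  have h1 := eigenEntry_cfc_left hA hB (fun x => x) j i
  have h2 := eigenEntry_cfc_right hA hB (fun x => x) j i
  rw [cfc_id' ℝ A hA.isSelfAdjoint] at h1
  rw [cfc_id' ℝ B hB.isSelfAdjoint] at h2
  have h3 : eigenEntry hA hB (A - B) j i = eigenEntry hA hB A j i - eigenEntry hA hB B j i := by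
    simp only [eigenEntry, Matrix.mul_sub, Matrix.sub_mul, Matrix.sub_apply]
  rw [h3, h1, h2]; push_cast; ring

theorem star_eigenEntry (hA : A.IsHermitian) (hB : B.IsHermitian) {C : Matrix n n ℂ}
    (hC : C.IsHermitian) (j i : n) :
    (star (hA.eigenvectorUnitary : Matrix n n ℂ) * C * (hB.eigenvectorUnitary : Matrix n n ℂ)) i j
      = star (eigenEntry hA hB C j i) := by
  rw [eigenEntry, ← Matrix.star_apply, star_mul, star_mul, star_star, Matrix.star_eq_conjTranspose C,
    hC.eq, Matrix.mul_assoc]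

theorem trace_sq_mul_cfc_left (hA : A.IsHermitian) (hB : B.IsHermitian) {C : Matrix n n ℂ}
    (hC : C.IsHermitian) (ψ : ℝ → ℝ) :
    (C * C * cfc ψ A).trace = ((∑ j, ∑ i, ψ (hA.eigenvalues i) *
      ‖eigenEntry hA hB C j i‖ ^ 2 : ℝ) : ℂ) := by
  have h : (C * C * cfc ψ A).trace = (star (hB.eigenvectorUnitary : Matrix n n ℂ) * C
      * (hA.eigenvectorUnitary : Matrix n n ℂ)
      * Matrix.diagonal (fun i => ((ψ (hA.eigenvalues i) : ℝ) : ℂ))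
      * (star (hA.eigenvectorUnitary : Matrix n n ℂ) * C
        * (hB.eigenvectorUnitary : Matrix n n ℂ))).trace := by
    conv_rhs => rw [← Matrix.mul_assoc, Matrix.trace_mul_comm]
    rw [Matrix.mul_assoc C, Matrix.trace_mul_comm C]
    simp only [← Matrix.mul_assoc]
    rw [hB.unitary_mul_star, Matrix.one_mul, hA.cfc_eq_mul]
    simp only [← Matrix.mul_assoc]
  rw [h, trace_mul_diagonal_mul]
  simp only [star_eigenEntry hA hB hC]
  push_cast
  refine Finset.sum_congr rfl fun j _ => Finset.sum_congr rfl fun i _ => ?_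
  congr 1
  exact Complex.mul_conj' _

theorem trace_sq_mul_cfc_right (hA : A.IsHermitian) (hB : B.IsHermitian) {C : Matrix n n ℂ}
    (hC : C.IsHermitian) (ψ : ℝ → ℝ) :
    (C * C * cfc ψ B).trace = ((∑ j, ∑ i, ψ (hB.eigenvalues j) *
      ‖eigenEntry hA hB C j i‖ ^ 2 : ℝ) : ℂ) := by
  have h : (C * C * cfc ψ B).trace = (star (hB.eigenvectorUnitary : Matrix n n ℂ) * C
      * (hA.eigenvectorUnitary : Matrix n n ℂ)
      * (star (hA.eigenvectorUnitary : Matrix n n ℂ) * C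
        * (hB.eigenvectorUnitary : Matrix n n ℂ))
      * Matrix.diagonal (fun i => ((ψ (hB.eigenvalues i) : ℝ) : ℂ))).trace := by
    simp only [Matrix.mul_assoc]
    rw [Matrix.trace_mul_comm (star (hB.eigenvectorUnitary : Matrix n n ℂ))]
    simp only [Matrix.mul_assoc]
    rw [← Matrix.mul_assoc (hA.eigenvectorUnitary : Matrix n n ℂ), hA.unitary_mul_star,
      Matrix.one_mul, hB.cfc_eq_mul]
    simp only [Matrix.mul_assoc]
  rw [h, trace_mul_diagonal_mul']
  simp only [star_eigenEntry hA hB hC]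
  push_cast
  refine Finset.sum_congr rfl fun j _ => Finset.sum_congr rfl fun i _ => ?_
  congr 1
  exact Complex.mul_conj' _

/-- The mean value trace inequality. -/
theorem re_trace_mul_cfc_sub_le (hA : A.IsHermitian) (hB : B.IsHermitian) {C : Matrix n n ℂ}
    (hC : C.IsHermitian) {φ ψ : ℝ → ℝ}
    (hφ : ∀ a b, |φ a - φ b| ≤ |a - b| * ((ψ a + ψ b) / 2)) (hψ : ∀ a, 0 ≤ ψ a)
    {τ : ℝ} (hτ : 0 < τ) :
    (C * (cfc φ A - cfc φ B)).trace.re ≤ 1 / 4 *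
      (τ * (((A - B) * (A - B) * cfc ψ A).trace.re + ((A - B) * (A - B) * cfc ψ B).trace.re)
        + τ⁻¹ * ((C * C * cfc ψ A).trace.re + (C * C * cfc ψ B).trace.re)) := by
  rw [Matrix.mul_sub, Matrix.trace_sub, trace_mul_cfc_left hA hB, trace_mul_cfc_right hA hB,
    trace_sq_mul_cfc_left hA hB (hA.sub hB), trace_sq_mul_cfc_right hA hB (hA.sub hB),
    trace_sq_mul_cfc_left hA hB hC, trace_sq_mul_cfc_right hA hB hC]
  simp only [Complex.ofReal_re, ← Finset.sum_sub_distrib, ← Finset.sum_add_distrib,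
    Finset.mul_sum, Complex.re_sum]
  refine Finset.sum_le_sum fun j _ => Finset.sum_le_sum fun i _ => ?_
  rw [eigenEntry_sub, ← sub_mul, ← Complex.ofReal_sub]
  set a := hA.eigenvalues i
  set b := hB.eigenvalues j
  set x := eigenEntry hA hB C j i
  set y := eigenEntry hA hB 1 j i
  have h1 : (((φ a - φ b : ℝ) : ℂ) * (x * star y)).re ≤ |φ a - φ b| * (‖x‖ * ‖y‖) := by
    refine (Complex.re_le_norm _).trans ?_
    rw [norm_mul, norm_mul, norm_star, Complex.norm_real, Real.norm_eq_abs]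
  have h2 : |φ a - φ b| * (‖x‖ * ‖y‖) ≤ |a - b| * ((ψ a + ψ b) / 2) * (‖x‖ * ‖y‖) :=
    mul_le_mul_of_nonneg_right (hφ a b) (by positivity)
  rw [norm_mul, Complex.norm_real, Real.norm_eq_abs]
  -- The inequality holds entry by entry: this is the arithmetic–geometric mean inequality with
  -- weight `τ`, later multiplied by `ψ a + ψ b`.
  have h3 : 2 * ((|a - b| * ‖y‖) * ‖x‖) ≤ τ * (|a - b| * ‖y‖) ^ 2 + τ⁻¹ * ‖x‖ ^ 2 := by
    have : 0 ≤ τ⁻¹ * (τ * (|a - b| * ‖y‖) - ‖x‖) ^ 2 := by positivity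
    have e : τ⁻¹ * (τ * (|a - b| * ‖y‖) - ‖x‖) ^ 2
        = τ * (|a - b| * ‖y‖) ^ 2 + τ⁻¹ * ‖x‖ ^ 2 - 2 * ((|a - b| * ‖y‖) * ‖x‖) := by
      field_simp; ring
    linarith
  have h4 := mul_le_mul_of_nonneg_left h3 (add_nonneg (hψ a) (hψ b))
  linarith

/-- A trace version of a scalar inequality that involves two variables. -/
theorem re_trace_cfc_mul_cfc_le (hA : A.IsHermitian) (hB : B.IsHermitian) {x y u v : ℝ → ℝ}
    (h : ∀ i j, x (hA.eigenvalues i) * y (hB.eigenvalues j)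
      ≤ u (hA.eigenvalues i) + v (hB.eigenvalues j)) :
    (cfc x A * cfc y B).trace.re ≤ (cfc u A).trace.re + (cfc v B).trace.re := by
  have h1 := trace_mul_cfc_left hA hB 1 u
  have h2 := trace_mul_cfc_right hA hB 1 v
  rw [Matrix.one_mul] at h1 h2
  rw [h1, h2, trace_mul_cfc_right hA hB]
  simp only [Complex.re_sum, ← Finset.sum_add_distrib, eigenEntry_cfc_left]
  refine Finset.sum_le_sum fun j _ => Finset.sum_le_sum fun i _ => ?_
  set w := eigenEntry hA hB 1 j i
  have hw : w * star w = ((‖w‖ ^ 2 : ℝ) : ℂ) := by push_cast; exact Complex.mul_conj' _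
  rw [mul_assoc, hw]
  simp only [← Complex.ofReal_mul, Complex.ofReal_re]
  have := mul_le_mul_of_nonneg_right (h i j) (sq_nonneg ‖w‖)
  linarith

end TwoBases

/-! ### Scalar inequalities. -/

section ScalarInequalities

/-- The trapezoidal rule overestimates the integral of the convex function `(p+1) x^p`. As a
function of the upper endpoint the excess is monotone, its derivative being nonnegative by
Bernoulli's inequality at `b / x`; this is where `1 ≤ p` enters. -/
theorem rpow_succ_sub_le_of_nonneg {p a b : ℝ} (hp : 1 ≤ p) (hb : 0 ≤ b) (hab : b ≤ a) :
    a ^ (p + 1) - b ^ (p + 1) ≤ (a - b) * ((p + 1) * (a ^ p + b ^ p) / 2) := by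
  set h : ℝ → ℝ := fun x => (x - b) * ((p + 1) * (x ^ p + b ^ p) / 2) - x ^ (p + 1) with hh
  have hd : ∀ x, HasDerivAt h (1 * ((p + 1) * (x ^ p + b ^ p) / 2)
      + (x - b) * ((p + 1) * (p * x ^ (p - 1) + 0) / 2) - (p + 1) * x ^ (p + 1 - 1)) x := fun x =>
    ((((hasDerivAt_id x).sub_const b).mul
      ((((Real.hasDerivAt_rpow_const (Or.inr hp)).add (hasDerivAt_const _ _)).const_mul
        (p + 1)).div_const 2))).sub (Real.hasDerivAt_rpow_const (Or.inr (by linarith)))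
  have hm : MonotoneOn h (Set.Icc b a) := by
    refine monotoneOn_of_deriv_nonneg (convex_Icc b a)
      (fun x _ => (hd x).continuousAt.continuousWithinAt)
      (fun x _ => (hd x).differentiableAt.differentiableWithinAt) fun x hx => ?_
    rw [interior_Icc] at hx
    have hx0 : 0 < x := hb.trans_lt hx.1
    rw [(hd x).deriv, add_sub_cancel_right]
    have hB := one_add_mul_self_le_rpow_one_add (s := b / x - 1)
      (by linarith [div_nonneg hb hx0.le]) hp
    rw [add_sub_cancel, Real.div_rpow hb hx0.le] at hB
    have hxp : 0 < x ^ p := Real.rpow_pos_of_pos hx0 p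
    have h1 : x ^ (p - 1) = x ^ p / x := by rw [Real.rpow_sub_one hx0.ne']
    have h2 := mul_le_mul_of_nonneg_right hB hxp.le
    rw [div_mul_cancel₀ _ hxp.ne'] at h2
    rw [h1]
    have h3 : 1 * ((p + 1) * (x ^ p + b ^ p) / 2)
      + (x - b) * ((p + 1) * (p * (x ^ p / x) + 0) / 2) - (p + 1) * x ^ p
      = (p + 1) / 2 * (b ^ p - (1 + p * (b / x - 1)) * x ^ p) := by
      field_simp; ring
    rw [h3]
    exact mul_nonneg (by linarith) (sub_nonneg.2 h2)
  have := hm (Set.left_mem_Icc.2 hab) (Set.right_mem_Icc.2 hab) hab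
  simp only [hh, sub_self, zero_mul] at this
  linarith

/-- The trapezoidal bound for the increments of `x ↦ x |x|^p`. -/
theorem abs_mul_rpow_sub_le {p : ℝ} (hp : p = 0 ∨ 1 ≤ p) (a b : ℝ) :
    |a * |a| ^ p - b * |b| ^ p| ≤ |a - b| * (((p + 1) * |a| ^ p + (p + 1) * |b| ^ p) / 2) := by
  rcases hp with rfl | hp
  -- Since `0 ^ 0 = 1`, both sides are `|a - b|`.
  · simp
  have hp1 : p + 1 ≠ 0 := by linarith
  have succ : ∀ x : ℝ, 0 ≤ x → x * x ^ p = x ^ (p + 1) := fun x hx => by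
    rw [Real.rpow_add_one' hx hp1, mul_comm]
  have pos : ∀ a b : ℝ, 0 ≤ b → b ≤ a → |a * |a| ^ p - b * |b| ^ p| ≤
      |a - b| * (((p + 1) * |a| ^ p + (p + 1) * |b| ^ p) / 2) := fun a b hb hab => by
    have ha := hb.trans hab
    rw [abs_of_nonneg ha, abs_of_nonneg hb, succ a ha, succ b hb, abs_of_nonneg (sub_nonneg.2 hab),
      abs_of_nonneg (sub_nonneg.2 (Real.rpow_le_rpow hb hab (by linarith)))]
    have := rpow_succ_sub_le_of_nonneg hp hb hab
    rwa [mul_add] at this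
  have opp : ∀ a b : ℝ, 0 ≤ a → b ≤ 0 → |a * |a| ^ p - b * |b| ^ p| ≤
      |a - b| * (((p + 1) * |a| ^ p + (p + 1) * |b| ^ p) / 2) := fun a b ha hb => by
    have hnb : 0 ≤ -b := neg_nonneg.2 hb
    rw [abs_of_nonneg ha, abs_of_nonpos hb, abs_of_nonneg (by linarith : 0 ≤ a - b)]
    have h1 : 0 ≤ a ^ p := Real.rpow_nonneg ha p
    have h2 : 0 ≤ (-b) ^ p := Real.rpow_nonneg hnb p
    have h3 := mul_nonneg ha h1
    have h4 := mul_nonneg ha h2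
    have h5 := mul_nonneg hnb h1
    have h6 := mul_nonneg hnb h2
    rw [abs_of_nonneg (by linarith)]
    -- For opposite signs the bound already holds with constant `1` in place of `(p + 1) / 2`; the
    -- surplus is nonnegative because `1 ≤ p`.
    have h7 : 0 ≤ (p - 1) / 2 * ((a - b) * (a ^ p + (-b) ^ p)) :=
      mul_nonneg (by linarith) (mul_nonneg (by linarith) (by linarith))
    linarith
  have swap : ∀ a b : ℝ, |b * |b| ^ p - a * |a| ^ p| ≤
      |b - a| * (((p + 1) * |b| ^ p + (p + 1) * |a| ^ p) / 2) →
      |a * |a| ^ p - b * |b| ^ p| ≤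
      |a - b| * (((p + 1) * |a| ^ p + (p + 1) * |b| ^ p) / 2) := fun a b h => by
    rwa [abs_sub_comm, abs_sub_comm a b, add_comm ((p + 1) * |a| ^ p)]
  have main : ∀ a b : ℝ, b ≤ a → |a * |a| ^ p - b * |b| ^ p| ≤
      |a - b| * (((p + 1) * |a| ^ p + (p + 1) * |b| ^ p) / 2) := fun a b hab => by
    rcases le_total 0 b with hb | hb
    · exact pos a b hb hab
    rcases le_total 0 a with ha | ha
    · exact opp a b ha hb
    · have := pos (-b) (-a) (by linarith) (by linarith)
      simp only [abs_neg, neg_mul, sub_neg_eq_add] at this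
      rw [neg_add_eq_sub, neg_add_eq_sub] at this
      rwa [add_comm ((p + 1) * |a| ^ p)]
  rcases le_total b a with h | h
  · exact main a b h
  · exact swap a b (main b a h)

/-- Weighted arithmetic–geometric means with weights `1/q` and `1 - 1/q`. This form needs no
conjugate exponent, so `q = 1` is included. -/
theorem young_mul_abs_rpow {q k x : ℝ} (hq : 1 ≤ q) (hk : 0 ≤ k) (hx : 0 ≤ x) (y : ℝ) :
    k * x * |y| ^ (2 * q - 2) ≤ k ^ q / q * x ^ q + (1 - 1 / q) * |y| ^ (2 * q) := by
  have hq0 : 0 < q := by linarith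
  have h := Real.geom_mean_le_arith_mean2_weighted (w₁ := 1 / q) (w₂ := 1 - 1 / q)
    (p₁ := (k * x) ^ q) (p₂ := |y| ^ (2 * q)) (by positivity)
    (sub_nonneg.2 ((div_le_one hq0).2 hq)) (by positivity) (by positivity) (by ring)
  rw [← Real.rpow_mul (by positivity), ← Real.rpow_mul (by positivity),
    mul_one_div_cancel hq0.ne', Real.rpow_one, Real.mul_rpow hk hx] at h
  have e : 2 * q * (1 - 1 / q) = 2 * q - 2 := by field_simp
  rw [e] at h
  refine h.trans_eq ?_
  ring

end ScalarInequalities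

/-! ### Trace functions of Hermitian matrices: positivity, Young's inequality, measurability,
growth. -/

section TraceFunctions

variable {n : Type*} [Fintype n] [DecidableEq n] {A B : Matrix n n ℂ}

theorem re_trace_cfc (hA : A.IsHermitian) (u : ℝ → ℝ) :
    (cfc u A).trace.re = ∑ i, u (hA.eigenvalues i) := by
  rw [hA.cfc_eq_mul, Matrix.trace_mul_cycle, hA.star_mul_unitary, Matrix.one_mul,
    Matrix.trace_diagonal, Complex.re_sum]
  rfl

theorem re_trace_mul_cfc_nonneg (hA : A.PosSemidef) (hB : B.IsHermitian) {ψ : ℝ → ℝ}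
    (hψ : ∀ x, 0 ≤ ψ x) : 0 ≤ (A * cfc ψ B).trace.re := by
  have h := re_trace_cfc_mul_cfc_le hA.isHermitian hB (x := fun x => -x) (y := ψ)
    (u := fun _ => 0) (v := fun _ => 0) fun i j => by
      have := mul_nonneg (hA.eigenvalues_nonneg i) (hψ (hB.eigenvalues j))
      linarith
  rw [re_trace_cfc hA.isHermitian, re_trace_cfc hB, cfc_neg_id A hA.isHermitian.isSelfAdjoint,
    Matrix.neg_mul, Matrix.trace_neg, Complex.neg_re] at h
  simpa using h

theorem re_trace_mul_cfc_rpow_le (hA : A.PosSemidef) (hB : B.IsHermitian) {c q : ℝ} (hc : 0 ≤ c)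
    (hq : 1 ≤ q) :
    c * (A * cfc (fun x : ℝ => (2 * q - 1) * |x| ^ (2 * q - 2)) B).trace.re
      ≤ (c * (2 * q - 1)) ^ q / q * (cfc (fun x : ℝ => x ^ q) A).trace.re
        + (1 - 1 / q) * (cfc (fun x : ℝ => |x| ^ (2 * q)) B).trace.re := by
  have h := re_trace_cfc_mul_cfc_le hA.isHermitian hB (x := fun x => c * x)
    (y := fun x : ℝ => (2 * q - 1) * |x| ^ (2 * q - 2))
    (u := fun x => (c * (2 * q - 1)) ^ q / q * x ^ q)
    (v := fun x => (1 - 1 / q) * |x| ^ (2 * q)) fun i j => by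
      have := young_mul_abs_rpow hq (mul_nonneg hc (by linarith : 0 ≤ 2 * q - 1))
        (hA.eigenvalues_nonneg i) (hB.eigenvalues j)
      linarith
  rw [cfc_const_mul_id c A hA.isHermitian.isSelfAdjoint, re_trace_cfc hA.isHermitian,
    re_trace_cfc hB, Matrix.smul_mul, Matrix.trace_smul, Complex.smul_re, smul_eq_mul,
    ← Finset.mul_sum, ← Finset.mul_sum] at h
  rwa [re_trace_cfc hA.isHermitian, re_trace_cfc hB]

theorem re_trace_mul_cfc_self (hA : A.IsHermitian) {q : ℝ} (hq : 1 ≤ q) :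
    (A * cfc (fun x : ℝ => x * |x| ^ (2 * q - 2)) A).trace.re
      = (cfc (fun x : ℝ => |x| ^ (2 * q)) A).trace.re := by
  have h1 := trace_mul_cfc_left hA hA A (fun x : ℝ => x * |x| ^ (2 * q - 2))
  have h2 := trace_mul_cfc_left hA hA 1 (fun x : ℝ => |x| ^ (2 * q))
  rw [Matrix.one_mul] at h2
  rw [h1, h2]
  congr 1
  refine Finset.sum_congr rfl fun j _ => Finset.sum_congr rfl fun i _ => ?_
  have h3 := eigenEntry_cfc_left hA hA (fun x => x) j i
  rw [cfc_id' ℝ A hA.isSelfAdjoint] at h3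
  rw [h3, ← mul_assoc, ← mul_assoc, ← Complex.ofReal_mul, ← mul_assoc]
  congr 3
  rw [mul_right_comm, ← sq, ← sq_abs, ← Real.rpow_natCast,
    ← Real.rpow_add_of_nonneg (abs_nonneg _) (by norm_num) (by linarith)]
  norm_num

open scoped Matrix.Norms.L2Operator

theorem Matrix.IsHermitian.norm_le_of_mem_spectrum (hA : A.IsHermitian) {x : ℝ}
    (hx : x ∈ spectrum ℝ A) : |x| ≤ ‖A‖ := by
  have := norm_apply_le_norm_cfc (fun x : ℝ => x) A hx (by fun_prop) hA.isSelfAdjoint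
  rwa [cfc_id' ℝ A hA.isSelfAdjoint] at this

/-- `cfc` takes a default value off the self-adjoint matrices. Composition with the Hermitian part
gives a function continuous on the whole matrix space. -/
theorem continuous_cfc_realPart {φ : ℝ → ℝ} (hφ : Continuous φ) :
    Continuous fun A : Matrix n n ℂ => cfc φ ((1 / 2 : ℝ) • (A + A.conjTranspose)) := by
  refine Continuous.cfc_of_mem_nhdsSet (A := Matrix n n ℂ) (s := Set.univ) φ univ_mem ?_ ?_ hφ.continuousOn
  · have h : Continuous fun A : Matrix n n ℂ => A.conjTranspose :=
      continuous_id.matrix_conjTranspose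
    exact (continuous_id.add h).const_smul (1 / 2 : ℝ)
  · intro A
    rw [IsSelfAdjoint, Matrix.star_eq_conjTranspose, Matrix.conjTranspose_smul,
      Matrix.conjTranspose_add, Matrix.conjTranspose_conjTranspose, add_comm, star_trivial]

theorem stronglyMeasurable_cfc {Ω : Type*} [MeasurableSpace Ω] {f : Ω → Matrix n n ℂ}
    (hf : StronglyMeasurable f) (hH : ∀ z, (f z).IsHermitian) {φ : ℝ → ℝ} (hφ : Continuous φ) :
    StronglyMeasurable fun z => cfc φ (f z) := by
  have h : (fun z => cfc φ (f z))
      = fun z => cfc φ ((1 / 2 : ℝ) • (f z + (f z).conjTranspose)) := by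
    funext z
    rw [(hH z).eq, ← two_smul ℝ (f z), smul_smul]
    norm_num
  rw [h]
  exact (continuous_cfc_realPart hφ).comp_stronglyMeasurable hf

theorem norm_cfc_le_rpow (hA : A.IsHermitian) {φ : ℝ → ℝ} {C p : ℝ} (hC : 0 ≤ C) (hp : 0 ≤ p)
    (hφ : ∀ x, |φ x| ≤ C * |x| ^ p) : ‖cfc φ A‖ ≤ C * ‖A‖ ^ p :=
  norm_cfc_le (by positivity) fun x hx => (hφ x).trans
    (mul_le_mul_of_nonneg_left (Real.rpow_le_rpow (abs_nonneg x) (hA.norm_le_of_mem_spectrum hx) hp)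
      hC)

end TraceFunctions

section OperatorNorm

open scoped Matrix.Norms.L2Operator

/-! ### Matrix-valued functions through their real coordinates. -/

section MatrixCoordinates

variable {d : ℕ}

theorem matrix_eq_sum_re_im (A : Matrix (Fin d) (Fin d) ℂ) :
    A = ∑ i, ∑ j, ((A i j).re • Matrix.single i j (1 : ℂ)
      + (A i j).im • Matrix.single i j Complex.I) := by
  conv_lhs => rw [Matrix.matrix_eq_sum_single A]
  refine Finset.sum_congr rfl fun i _ => Finset.sum_congr rfl fun j _ => ?_
  rw [Matrix.smul_single, Matrix.smul_single, ← Matrix.single_add]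
  congr 1
  rw [Complex.real_smul, Complex.real_smul, mul_one, Complex.re_add_im]

/-- Evaluation of an entry, as a continuous linear map. -/
noncomputable def entryCLM (i j : Fin d) : Matrix (Fin d) (Fin d) ℂ →L[ℝ] ℂ :=
  LinearMap.toContinuousLinearMap (Matrix.entryLinearMap ℝ ℂ i j)

variable {Ω : Type*} [MeasurableSpace Ω] {X : Ω → Matrix (Fin d) (Fin d) ℂ}

theorem stronglyMeasurable_of_entries (hre : ∀ i j, Measurable fun z => (X z i j).re)
    (him : ∀ i j, Measurable fun z => (X z i j).im) : StronglyMeasurable X := by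
  have h : X = fun z => ∑ i, ∑ j, ((X z i j).re • Matrix.single i j (1 : ℂ)
      + (X z i j).im • Matrix.single i j Complex.I) :=
    funext fun z => matrix_eq_sum_re_im (X z)
  rw [h]
  refine Finset.stronglyMeasurable_fun_sum _ fun i _ => Finset.stronglyMeasurable_fun_sum _
    fun j _ => ?_
  exact ((hre i j).stronglyMeasurable.smul_const _).add ((him i j).stronglyMeasurable.smul_const _)

theorem memLp_of_entries {ν : Measure Ω} {p : ENNReal}
    (hre : ∀ i j, MemLp (fun z => (X z i j).re) p ν)
    (him : ∀ i j, MemLp (fun z => (X z i j).im) p ν) : MemLp X p ν := by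
  have h : X = fun z => ∑ i, ∑ j, ((X z i j).re • Matrix.single i j (1 : ℂ)
      + (X z i j).im • Matrix.single i j Complex.I) :=
    funext fun z => matrix_eq_sum_re_im (X z)
  rw [h]
  refine memLp_finsetSum _ fun i _ => memLp_finsetSum _ fun j _ => ?_
  have h1 (a : Ω → ℝ) (ha : MemLp a p ν) (B : Matrix (Fin d) (Fin d) ℂ) :
      MemLp (fun z => a z • B) p ν :=
    ha.of_le_mul (c := ‖B‖) (ha.1.smul_const _) (Eventually.of_forall fun z => by
      rw [norm_smul, mul_comm])
  exact (h1 _ (hre i j) _).add (h1 _ (him i j) _)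

theorem tendsto_eLpNorm_of_entries {ν : Measure Ω} {α : Type*} {l : Filter α}
    {X : α → Ω → Matrix (Fin d) (Fin d) ℂ}
    (hm : ∀ a i j, Measurable fun z => (X a z i j).re)
    (hm' : ∀ a i j, Measurable fun z => (X a z i j).im)
    (hre : ∀ i j, Tendsto (fun a => eLpNorm (fun z => (X a z i j).re) 2 ν) l (𝓝 0))
    (him : ∀ i j, Tendsto (fun a => eLpNorm (fun z => (X a z i j).im) 2 ν) l (𝓝 0)) :
    Tendsto (fun a => eLpNorm (X a) 2 ν) l (𝓝 0) := by
  have hsm (b : Ω → ℝ) (B : Matrix (Fin d) (Fin d) ℂ) :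
      eLpNorm (fun z => b z • B) 2 ν ≤ ‖B‖ₑ * eLpNorm b 2 ν :=
    eLpNorm_le_nnreal_smul_eLpNorm_of_ae_le_mul (Eventually.of_forall fun z => by
      rw [nnnorm_smul, mul_comm]) _
  have hle : ∀ a, eLpNorm (X a) 2 ν ≤ ∑ i, ∑ j,
      (‖Matrix.single i j (1 : ℂ)‖ₑ * eLpNorm (fun z => (X a z i j).re) 2 ν
        + ‖Matrix.single i j Complex.I‖ₑ * eLpNorm (fun z => (X a z i j).im) 2 ν) := fun a => by
    have h : X a = ∑ i, ∑ j, ((fun z => (X a z i j).re • Matrix.single i j (1 : ℂ))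
        + fun z => (X a z i j).im • Matrix.single i j Complex.I) := by
      funext z
      simp only [Finset.sum_apply, Pi.add_apply]
      exact matrix_eq_sum_re_im (X a z)
    have hm1 (i j) : AEStronglyMeasurable
        (fun z => (X a z i j).re • Matrix.single i j (1 : ℂ)) ν :=
      ((hm a i j).stronglyMeasurable.smul_const _).aestronglyMeasurable
    have hm2 (i j) : AEStronglyMeasurable
        (fun z => (X a z i j).im • Matrix.single i j Complex.I) ν :=
      ((hm' a i j).stronglyMeasurable.smul_const _).aestronglyMeasurable
    conv_lhs => rw [h]
    refine (eLpNorm_sum_le (fun i _ => Finset.aestronglyMeasurable_sum _ fun j _ =>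
      (hm1 i j).add (hm2 i j)) one_le_two).trans (Finset.sum_le_sum fun i _ => ?_)
    refine (eLpNorm_sum_le (fun j _ => (hm1 i j).add (hm2 i j)) one_le_two).trans
      (Finset.sum_le_sum fun j _ => ?_)
    exact (eLpNorm_add_le (hm1 i j) (hm2 i j) one_le_two).trans (add_le_add (hsm _ _) (hsm _ _))
  refine tendsto_of_tendsto_of_tendsto_of_le_of_le tendsto_const_nhds ?_ (fun a => zero_le) hle
  have h0 : (0 : ENNReal) = ∑ i : Fin d, ∑ j : Fin d,
      (‖Matrix.single i j (1 : ℂ)‖ₑ * 0 + ‖Matrix.single i j Complex.I‖ₑ * 0) := by simp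
  rw [h0]
  refine tendsto_finsetSum _ fun i _ => tendsto_finsetSum _ fun j _ => ?_
  exact (ENNReal.Tendsto.const_mul (hre i j) (Or.inr enorm_ne_top)).add
    (ENNReal.Tendsto.const_mul (him i j) (Or.inr enorm_ne_top))

theorem matExpect_eq_integral {ν : Measure Ω} (hX : Integrable X ν) :
    matExpect ν X = ∫ y, X y ∂ν := by
  ext i j
  have := (entryCLM i j).integral_comp_comm hX
  exact this

end MatrixCoordinates

section Contraction

variable {Ω E : Type*} [MeasurableSpace Ω] [NormedAddCommGroup E] [NormedSpace ℝ E]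

/-- On each probability measure `κ z` the `L¹` norm is at most the `L^p` norm; integrating the
`p`-th powers against `μ`, invariance removes the kernel. -/
theorem eLpNorm_integral_kernel_le {μ : Measure Ω} {κ : Kernel Ω Ω} [IsMarkovKernel κ]
    (hκ : Kernel.Invariant κ μ) {X : Ω → E} (hX : StronglyMeasurable X) {p : ENNReal}
    (hp : 1 ≤ p) (hp' : p ≠ ⊤) :
    eLpNorm (fun z => ∫ y, X y ∂κ z) p μ ≤ eLpNorm X p μ := by
  have hp0 : p ≠ 0 := (zero_lt_one.trans_le hp).ne'
  have hpr : 0 < p.toReal := ENNReal.toReal_pos hp0 hp'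
  have hpt : ∀ z, ‖∫ y, X y ∂κ z‖ₑ ^ p.toReal ≤ ∫⁻ y, ‖X y‖ₑ ^ p.toReal ∂κ z := fun z => by
    have h1 : ‖∫ y, X y ∂κ z‖ₑ ≤ eLpNorm X p (κ z) :=
      (enorm_integral_le_lintegral_enorm _).trans
        (eLpNorm_one_eq_lintegral_enorm.symm.le.trans
          (eLpNorm_le_eLpNorm_of_exponent_le hp hX.aestronglyMeasurable))
    rw [eLpNorm_eq_lintegral_rpow_enorm_toReal hp0 hp'] at h1
    have h2 := ENNReal.rpow_le_rpow h1 hpr.le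
    rwa [← ENNReal.rpow_mul, one_div, inv_mul_cancel₀ hpr.ne', ENNReal.rpow_one] at h2
  rw [eLpNorm_eq_lintegral_rpow_enorm_toReal hp0 hp', eLpNorm_eq_lintegral_rpow_enorm_toReal hp0 hp']
  refine ENNReal.rpow_le_rpow ?_ (by positivity)
  have hm : Measurable fun y => ‖X y‖ₑ ^ p.toReal := hX.enorm.pow_const _
  calc ∫⁻ z, ‖∫ y, X y ∂κ z‖ₑ ^ p.toReal ∂μ ≤ ∫⁻ z, ∫⁻ y, ‖X y‖ₑ ^ p.toReal ∂κ z ∂μ :=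
        lintegral_mono hpt
    _ = ∫⁻ y, ‖X y‖ₑ ^ p.toReal ∂(μ.bind κ) :=
        (Measure.lintegral_bind κ.measurable.aemeasurable hm.aemeasurable).symm
    _ = _ := by rw [hκ.def]

end Contraction

/-! ### The algebra of suitable matrix-valued functions. -/

namespace MarkovSemigroup

variable {Ω : Type*} [MeasurableSpace Ω] {S : MarkovSemigroup Ω} {μ : Measure Ω}
  {𝒜 : Subalgebra ℝ (Ω → ℝ)} {d : ℕ}

/-- The algebra of matrix-valued functions whose entries have real and imaginary parts in `𝒜`. -/
def matAlgebra (𝒜 : Subalgebra ℝ (Ω → ℝ)) (d : ℕ) :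
    Subalgebra ℝ (Ω → Matrix (Fin d) (Fin d) ℂ) where
  carrier := {X | ∀ i j, (fun z => (X z i j).re) ∈ 𝒜 ∧ (fun z => (X z i j).im) ∈ 𝒜}
  add_mem' hX hY i j := ⟨𝒜.add_mem (hX i j).1 (hY i j).1, 𝒜.add_mem (hX i j).2 (hY i j).2⟩
  mul_mem' {X Y} hX hY i j := by
    constructor
    · have : (fun z => ((X * Y) z i j).re) = ∑ k, ((fun z => (X z i k).re) * (fun z => (Y z k j).re)
          - (fun z => (X z i k).im) * (fun z => (Y z k j).im)) := by
        funext z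
        simp [Matrix.mul_apply, Complex.mul_re]
      rw [this]
      exact 𝒜.sum_mem fun k _ => 𝒜.sub_mem (𝒜.mul_mem (hX i k).1 (hY k j).1)
        (𝒜.mul_mem (hX i k).2 (hY k j).2)
    · have : (fun z => ((X * Y) z i j).im) = ∑ k, ((fun z => (X z i k).re) * (fun z => (Y z k j).im)
          + (fun z => (X z i k).im) * (fun z => (Y z k j).re)) := by
        funext z
        simp [Matrix.mul_apply, Complex.mul_im]
      rw [this]
      exact 𝒜.sum_mem fun k _ => 𝒜.add_mem (𝒜.mul_mem (hX i k).1 (hY k j).2)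
        (𝒜.mul_mem (hX i k).2 (hY k j).1)
  algebraMap_mem' r i j := by
    constructor
    · have : (fun z => ((algebraMap ℝ (Ω → Matrix (Fin d) (Fin d) ℂ) r) z i j).re)
          = algebraMap ℝ (Ω → ℝ) (if i = j then r else 0) := by
        funext z
        simp only [Pi.algebraMap_apply, Matrix.algebraMap_matrix_apply]
        split_ifs <;> simp
      rw [this]
      exact 𝒜.algebraMap_mem _
    · have : (fun z => ((algebraMap ℝ (Ω → Matrix (Fin d) (Fin d) ℂ) r) z i j).im)
          = algebraMap ℝ (Ω → ℝ) 0 := by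
        funext z
        simp only [Pi.algebraMap_apply, Matrix.algebraMap_matrix_apply]
        split_ifs <;> simp
      rw [this]
      exact 𝒜.algebraMap_mem _

omit [MeasurableSpace Ω] in
theorem _root_.IsSuitableMat.mem {f : Ω → Matrix (Fin d) (Fin d) ℂ} (hf : IsSuitableMat 𝒜 f) :
    f ∈ matAlgebra 𝒜 d := fun i j => ⟨hf.re_mem i j, hf.im_mem i j⟩

omit [MeasurableSpace Ω] in
theorem const_mem_matAlgebra (M : Matrix (Fin d) (Fin d) ℂ) :
    (fun _ => M) ∈ matAlgebra 𝒜 d := fun i j =>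
  ⟨𝒜.algebraMap_mem (M i j).re, 𝒜.algebraMap_mem (M i j).im⟩

namespace IsSuitable

variable (h𝒜 : S.IsSuitable μ 𝒜)
include h𝒜

/-- Powers of `a` stay in the algebra, hence in `L²`, so `a` has moments of every finite order. -/
theorem memLp_of_ne_top [IsProbabilityMeasure μ] {a : Ω → ℝ} (ha : a ∈ 𝒜) {p : ENNReal}
    (hp : p ≠ ⊤) : MemLp a p μ := by
  obtain ⟨n, hn⟩ := ENNReal.exists_nat_gt hp
  have h1 : MemLp (a ^ (n + 1)) 2 μ := h𝒜.memLp _ (𝒜.pow_mem ha _)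
  have h2 : MemLp a (2 * (n + 1 : ℕ)) μ := by
    refine ⟨(h𝒜.measurable a ha).aestronglyMeasurable, ?_⟩
    have h3 := h1.2
    have h4 := eLpNorm_norm_rpow (μ := μ) (p := 2) a (q := ((n + 1 : ℕ) : ℝ)) (by positivity)
    have h5 : eLpNorm (fun x => ‖a x‖ ^ ((n + 1 : ℕ) : ℝ)) 2 μ = eLpNorm (a ^ (n + 1)) 2 μ := by
      refine eLpNorm_congr_norm_ae (Eventually.of_forall fun z => ?_)
      rw [Real.rpow_natCast, Pi.pow_apply, norm_pow, norm_pow, norm_norm]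
    rw [h5, ENNReal.ofReal_natCast] at h4
    rw [h4] at h3
    exact (ENNReal.rpow_lt_top_iff_of_pos (by positivity)).1 h3
  refine h2.mono_exponent (hn.le.trans ?_)
  push_cast
  calc (n : ENNReal) ≤ n + 1 := le_self_add
    _ = 1 * (n + 1) := (one_mul _).symm
    _ ≤ 2 * (n + 1) := by gcongr; exact one_le_two

variable {X : Ω → Matrix (Fin d) (Fin d) ℂ} (hX : X ∈ matAlgebra 𝒜 d)
include hX

theorem mat_stronglyMeasurable : StronglyMeasurable X :=
  stronglyMeasurable_of_entries (fun i j => h𝒜.measurable _ (hX i j).1)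
    fun i j => h𝒜.measurable _ (hX i j).2

theorem mat_memLp [IsProbabilityMeasure μ] {p : ENNReal} (hp : p ≠ ⊤) : MemLp X p μ :=
  memLp_of_entries (fun i j => h𝒜.memLp_of_ne_top (hX i j).1 hp)
    fun i j => h𝒜.memLp_of_ne_top (hX i j).2 hp

theorem mat_integrable (t : NNReal) (z : Ω) : Integrable X (S.kernel t z) :=
  memLp_one_iff_integrable.1 (memLp_of_entries
    (fun i j => memLp_one_iff_integrable.2 (h𝒜.integrable _ (hX i j).1 t z))
    fun i j => memLp_one_iff_integrable.2 (h𝒜.integrable _ (hX i j).2 t z))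

theorem matAct_eq_integral (t : NNReal) (z : Ω) : S.matAct t X z = ∫ y, X y ∂S.kernel t z :=
  matExpect_eq_integral (h𝒜.mat_integrable hX t z)

theorem entry_integrable (t : NNReal) (z : Ω) (i j : Fin d) :
    Integrable (fun y => X y i j) (S.kernel t z) :=
  (entryCLM i j).integrable_comp (h𝒜.mat_integrable hX t z)

theorem matAct_re (t : NNReal) (z : Ω) (i j : Fin d) :
    (S.matAct t X z i j).re = S.act t (fun y => (X y i j).re) z :=
  (Complex.reCLM.integral_comp_comm (h𝒜.entry_integrable hX t z i j)).symm

theorem matAct_im (t : NNReal) (z : Ω) (i j : Fin d) :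
    (S.matAct t X z i j).im = S.act t (fun y => (X y i j).im) z :=
  (Complex.imCLM.integral_comp_comm (h𝒜.entry_integrable hX t z i j)).symm

theorem matAct_mem (t : NNReal) : S.matAct t X ∈ matAlgebra 𝒜 d := fun i j => by
  simp only [h𝒜.matAct_re hX, h𝒜.matAct_im hX]
  exact ⟨h𝒜.act_mem _ (hX i j).1 t, h𝒜.act_mem _ (hX i j).2 t⟩

omit hX in
theorem tendsto_generator {a : Ω → ℝ} (ha : a ∈ 𝒜) (z : Ω) :
    Tendsto (fun t : NNReal => (t : ℝ)⁻¹ • (S.act t a z - a z)) (𝓝[>] 0)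
      (𝓝 (S.generator a z)) :=
  tendsto_nhds_limUnder (h𝒜.exists_lim a ha z)

theorem tendsto_matGenerator_aux (z : Ω) :
    Tendsto (fun t : NNReal => (t : ℝ)⁻¹ • (S.matAct t X z - X z)) (𝓝[>] 0)
      (𝓝 (Matrix.of fun i j => (⟨S.generator (fun y => (X y i j).re) z,
        S.generator (fun y => (X y i j).im) z⟩ : ℂ))) := by
  refine tendsto_pi_nhds.2 fun i => tendsto_pi_nhds.2 fun j => ?_
  have h1 := h𝒜.tendsto_generator (hX i j).1 z
  have h2 := h𝒜.tendsto_generator (hX i j).2 z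
  have h3 := ((Complex.continuous_ofReal.tendsto _).comp h1).add
    (((Complex.continuous_ofReal.tendsto _).comp h2).mul_const Complex.I)
  have e : ∀ a b : ℝ, (a : ℂ) + b * Complex.I = ⟨a, b⟩ := fun a b => by
    apply Complex.ext <;> simp
  simp only [Function.comp_def, e] at h3
  refine h3.congr fun t => ?_
  apply Complex.ext
  · simp only [← h𝒜.matAct_re hX, Matrix.smul_apply, Matrix.sub_apply, Complex.smul_re,
      Complex.sub_re]
  · simp only [← h𝒜.matAct_im hX, Matrix.smul_apply, Matrix.sub_apply, Complex.smul_im,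
      Complex.sub_im]

theorem tendsto_matGenerator (z : Ω) :
    Tendsto (fun t : NNReal => (t : ℝ)⁻¹ • (S.matAct t X z - X z)) (𝓝[>] 0)
      (𝓝 (S.matGenerator X z)) :=
  tendsto_nhds_limUnder ⟨_, h𝒜.tendsto_matGenerator_aux hX z⟩

theorem matGenerator_apply (z : Ω) (i j : Fin d) : S.matGenerator X z i j =
    ⟨S.generator (fun y => (X y i j).re) z, S.generator (fun y => (X y i j).im) z⟩ := by
  have := tendsto_nhds_unique (h𝒜.tendsto_matGenerator hX z) (h𝒜.tendsto_matGenerator_aux hX z)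
  rw [this]; rfl

theorem matGenerator_mem : S.matGenerator X ∈ matAlgebra 𝒜 d := fun i j => by
  simp only [h𝒜.matGenerator_apply hX]
  exact ⟨h𝒜.generator_mem _ (hX i j).1, h𝒜.generator_mem _ (hX i j).2⟩

theorem tendsto_matGenerator_L2 :
    Tendsto (fun t : NNReal => eLpNorm ((t : ℝ)⁻¹ • (S.matAct t X - X) - S.matGenerator X) 2 μ)
      (𝓝[>] 0) (𝓝 0) := by
  have hmem (t : NNReal) :
      ((t : ℝ)⁻¹ • (S.matAct t X - X) - S.matGenerator X) ∈ matAlgebra 𝒜 d :=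
    Subalgebra.sub_mem _ (Subalgebra.smul_mem _ (Subalgebra.sub_mem _ (h𝒜.matAct_mem hX t) hX) _)
      (h𝒜.matGenerator_mem hX)
  refine tendsto_eLpNorm_of_entries (fun t i j => h𝒜.measurable _ (hmem t i j).1)
    (fun t i j => h𝒜.measurable _ (hmem t i j).2) (fun i j => ?_) (fun i j => ?_)
  · refine (h𝒜.tendsto_L2 _ (hX i j).1).congr fun t => ?_
    congr 1
    funext z
    rw [← h𝒜.matAct_re hX]
    simp only [Pi.sub_apply, Pi.smul_apply, Matrix.smul_apply, Matrix.sub_apply, Complex.sub_re,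
      Complex.smul_re, h𝒜.matGenerator_apply hX]
  · refine (h𝒜.tendsto_L2 _ (hX i j).2).congr fun t => ?_
    congr 1
    funext z
    rw [← h𝒜.matAct_im hX]
    simp only [Pi.sub_apply, Pi.smul_apply, Matrix.smul_apply, Matrix.sub_apply, Complex.sub_im,
      Complex.smul_im, h𝒜.matGenerator_apply hX]

end IsSuitable

end MarkovSemigroup

/-- The real part of the trace, as a continuous linear map. -/
noncomputable def traceReCLM (d : ℕ) : Matrix (Fin d) (Fin d) ℂ →L[ℝ] ℝ :=
  LinearMap.toContinuousLinearMap
    (Complex.reLm ∘ₗ Matrix.traceLinearMap (Fin d) ℝ ℂ)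

theorem holderTriple_two_four : ENNReal.HolderTriple 2 4 (4 / 3) := by
  constructor
  rw [ENNReal.inv_div (by simp) (by simp)]
  rw [← ENNReal.toReal_eq_toReal_iff' (by simp) (ENNReal.div_ne_top (by simp) (by simp)),
    ENNReal.toReal_add (by simp) (by simp)]
  norm_num

theorem holderTriple_four_fourThirds : ENNReal.HolderTriple 4 (4 / 3) 1 := by
  constructor
  rw [ENNReal.inv_div (by simp) (by simp)]
  rw [← ENNReal.toReal_eq_toReal_iff' (by simp [ENNReal.div_eq_top]) (by simp),
    ENNReal.toReal_add (by simp) (ENNReal.div_ne_top (by simp) (by simp))]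
  norm_num

theorem one_le_four_div_three : (1 : ENNReal) ≤ 4 / 3 := by
  rw [ENNReal.le_div_iff_mul_le (by simp) (by simp)]
  norm_num

/-! ### Hölder bounds and the concrete contraction calculus. -/

section Pairing

variable {Ω : Type*} [MeasurableSpace Ω] {μ : Measure Ω} {d : ℕ}

theorem integrable_traceRe_mul {p q : ENNReal} [ENNReal.HolderTriple p q 1]
    {X Y : Ω → Matrix (Fin d) (Fin d) ℂ}
    (hX : MemLp X p μ) (hY : MemLp Y q μ) : Integrable (fun z => (X z * Y z).trace.re) μ :=
  (traceReCLM d).integrable_comp (memLp_one_iff_integrable.1 (MemLp.of_bilin (r := 1)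
    (fun A B : Matrix (Fin d) (Fin d) ℂ => A * B) 1 hX hY (hX.1.mul hY.1)
    (Eventually.of_forall fun z => by
      rw [one_mul]; exact nnnorm_mul_le _ _)))

theorem abs_integral_traceRe_le {Z : Ω → Matrix (Fin d) (Fin d) ℂ} (hZ : MemLp Z 1 μ) :
    |∫ z, (Z z).trace.re ∂μ| ≤ ‖traceReCLM d‖ * (eLpNorm Z 1 μ).toReal := by
  have h1 : ∫ z, (Z z).trace.re ∂μ = traceReCLM d (∫ z, Z z ∂μ) :=
    (traceReCLM d).integral_comp_comm (memLp_one_iff_integrable.1 hZ)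
  rw [h1, ← Real.norm_eq_abs]
  refine ((traceReCLM d).le_opNorm _).trans (mul_le_mul_of_nonneg_left ?_ (norm_nonneg _))
  rw [← toReal_enorm]
  exact ENNReal.toReal_mono hZ.2.ne
    ((enorm_integral_le_lintegral_enorm _).trans eLpNorm_one_eq_lintegral_enorm.symm.le)

theorem eLpNorm_matrix_mul_le {p q r : ENNReal} [ENNReal.HolderTriple p q r]
    {X Y : Ω → Matrix (Fin d) (Fin d) ℂ} (hX : AEStronglyMeasurable X μ)
    (hY : AEStronglyMeasurable Y μ) : eLpNorm (X * Y) r μ ≤ eLpNorm X p μ * eLpNorm Y q μ := by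
  have := eLpNorm_le_eLpNorm_mul_eLpNorm_of_nnnorm (p := p) (q := q) (r := r) hX hY
    (fun A B : Matrix (Fin d) (Fin d) ℂ => A * B) 1 (Eventually.of_forall fun z => by
      rw [one_mul]; exact nnnorm_mul_le _ _)
  rwa [ENNReal.coe_one, one_mul] at this

end Pairing

namespace MarkovSemigroup.IsSuitable

variable {Ω : Type*} [MeasurableSpace Ω] {S : MarkovSemigroup Ω} {μ : Measure Ω}
  {𝒜 : Subalgebra ℝ (Ω → ℝ)} {d : ℕ}

theorem matAct_add (h𝒜 : S.IsSuitable μ 𝒜) {X Y : Ω → Matrix (Fin d) (Fin d) ℂ}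
    (hX : X ∈ matAlgebra 𝒜 d) (hY : Y ∈ matAlgebra 𝒜 d) (t : NNReal) (z : Ω) :
    S.matAct t (X + Y) z = S.matAct t X z + S.matAct t Y z := by
  rw [h𝒜.matAct_eq_integral hX, h𝒜.matAct_eq_integral hY,
    h𝒜.matAct_eq_integral (Subalgebra.add_mem _ hX hY)]
  exact integral_add (h𝒜.mat_integrable hX _ z) (h𝒜.mat_integrable hY _ z)

theorem matAct_smul (h𝒜 : S.IsSuitable μ 𝒜) {X : Ω → Matrix (Fin d) (Fin d) ℂ}
    (hX : X ∈ matAlgebra 𝒜 d) (r : ℝ) (t : NNReal) (z : Ω) :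
    S.matAct t (r • X) z = r • S.matAct t X z := by
  rw [h𝒜.matAct_eq_integral hX, h𝒜.matAct_eq_integral (Subalgebra.smul_mem _ hX r)]
  exact integral_smul r _

/-- The semigroup acting on the algebra of suitable matrix-valued functions. -/
noncomputable def actL (h𝒜 : S.IsSuitable μ 𝒜) (d : ℕ) (t : ℝ) :
    matAlgebra 𝒜 d →ₗ[ℝ] matAlgebra 𝒜 d where
  -- Negative times are truncated to `0`, so contractivity needs no sign condition on `t`.
  toFun X := ⟨S.matAct t.toNNReal X.1, h𝒜.matAct_mem X.2 _⟩
  map_add' X Y := Subtype.ext (funext fun z => h𝒜.matAct_add X.2 Y.2 _ z)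
  map_smul' r X := Subtype.ext (funext fun z => h𝒜.matAct_smul X.2 r _ z)

theorem actL_apply (h𝒜 : S.IsSuitable μ 𝒜) (t : ℝ) (X : matAlgebra 𝒜 d) (z : Ω) :
    (h𝒜.actL d t X).1 z = ∫ y, X.1 y ∂S.kernel t.toNNReal z :=
  h𝒜.matAct_eq_integral X.2 _ z

/-- The generator acting on the algebra of suitable matrix-valued functions. -/
noncomputable def genL (h𝒜 : S.IsSuitable μ 𝒜) (d : ℕ) :
    matAlgebra 𝒜 d →ₗ[ℝ] matAlgebra 𝒜 d where
  toFun X := ⟨S.matGenerator X.1, h𝒜.matGenerator_mem X.2⟩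
  map_add' X Y := by
    refine Subtype.ext (funext fun z => ?_)
    refine tendsto_nhds_unique (h𝒜.tendsto_matGenerator (X + Y).2 z)
      (((h𝒜.tendsto_matGenerator X.2 z).add (h𝒜.tendsto_matGenerator Y.2 z)).congr fun t => ?_)
    rw [Subalgebra.coe_add, h𝒜.matAct_add X.2 Y.2, Pi.add_apply, add_sub_add_comm, smul_add]
  map_smul' r X := by
    refine Subtype.ext (funext fun z => ?_)
    refine tendsto_nhds_unique (h𝒜.tendsto_matGenerator (r • X).2 z)
      (((h𝒜.tendsto_matGenerator X.2 z).const_smul r).congr fun t => ?_)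
    rw [SetLike.val_smul, h𝒜.matAct_smul X.2, Pi.smul_apply, ← smul_sub, smul_comm]

/-- The `L²(μ)` seminorm on the algebra of suitable matrix-valued functions. -/
noncomputable def seminormL2 [IsProbabilityMeasure μ] (h𝒜 : S.IsSuitable μ 𝒜) (d : ℕ) :
    Seminorm ℝ (matAlgebra 𝒜 d) :=
  Seminorm.of (fun X => (eLpNorm X.1 2 μ).toReal)
    (fun X Y => by
      rw [← ENNReal.toReal_add (h𝒜.mat_memLp X.2 (by simp)).2.ne
        (h𝒜.mat_memLp Y.2 (by simp)).2.ne]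
      exact ENNReal.toReal_mono (ENNReal.add_ne_top.2 ⟨(h𝒜.mat_memLp X.2 (by simp)).2.ne,
        (h𝒜.mat_memLp Y.2 (by simp)).2.ne⟩)
        (eLpNorm_add_le (h𝒜.mat_memLp X.2 (p := 2) (by simp)).1
          (h𝒜.mat_memLp Y.2 (p := 2) (by simp)).1 one_le_two))
    (fun r X => by
      have : eLpNorm (r • X).1 2 μ = ‖r‖ₑ * eLpNorm X.1 2 μ := eLpNorm_const_smul r X.1 2 μ
      rw [this, ENNReal.toReal_mul, toReal_enorm])

variable [IsProbabilityMeasure μ]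

theorem seminormL2_apply (h𝒜 : S.IsSuitable μ 𝒜) (X : matAlgebra 𝒜 d) :
    h𝒜.seminormL2 d X = (eLpNorm X.1 2 μ).toReal := rfl

theorem seminormL2_eq_zero_iff (h𝒜 : S.IsSuitable μ 𝒜) (X : matAlgebra 𝒜 d) :
    h𝒜.seminormL2 d X = 0 ↔ X.1 =ᵐ[μ] 0 := by
  have h := h𝒜.mat_memLp X.2 (p := 2) (by simp)
  rw [seminormL2_apply, ENNReal.toReal_eq_zero_iff, or_iff_left h.2.ne,
    eLpNorm_eq_zero_iff h.1 (by simp)]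

theorem tendsto_toNNReal_nhdsGT : Tendsto Real.toNNReal (𝓝[>] (0 : ℝ)) (𝓝[>] (0 : NNReal)) := by
  refine tendsto_nhdsWithin_iff.2 ⟨?_, ?_⟩
  · have := (continuous_real_toNNReal.tendsto 0)
    rw [Real.toNNReal_zero] at this
    exact this.mono_left nhdsWithin_le_nhds
  · filter_upwards [self_mem_nhdsWithin] with r (hr : 0 < r)
    exact Real.toNNReal_pos.2 hr

omit [IsProbabilityMeasure μ] in
theorem eLpNorm_matAct_le (h𝒜 : S.IsSuitable μ 𝒜) (hstat : S.IsStationary μ)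
    {X : Ω → Matrix (Fin d) (Fin d) ℂ} (hX : X ∈ matAlgebra 𝒜 d) (t : NNReal) {p : ENNReal}
    (hp : 1 ≤ p) (hp' : p ≠ ⊤) : eLpNorm (S.matAct t X) p μ ≤ eLpNorm X p μ := by
  have := S.isMarkov t
  have h : S.matAct t X = fun z => ∫ y, X y ∂S.kernel t z :=
    funext fun z => h𝒜.matAct_eq_integral hX t z
  rw [h]
  exact eLpNorm_integral_kernel_le (hstat t) (h𝒜.mat_stronglyMeasurable hX) hp hp'

theorem isContractionCalculus (h𝒜 : S.IsSuitable μ 𝒜) (hstat : S.IsStationary μ) (d : ℕ) :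
    IsContractionCalculus (h𝒜.actL d) (h𝒜.genL d) (h𝒜.seminormL2 d) where
  zero X := by
    refine Subtype.ext (funext fun z => ?_)
    rw [actL_apply, Real.toNNReal_zero, S.kernel_zero, Kernel.id_apply]
    exact integral_dirac' _ _ (h𝒜.mat_stronglyMeasurable X.2)
  add s t X hs ht := by
    refine Subtype.ext (funext fun z => ?_)
    simp only [actL_apply]
    have hi := h𝒜.mat_integrable X.2 (s + t).toNNReal z
    rw [Real.toNNReal_add hs ht, S.kernel_add] at hi ⊢
    exact Kernel.integral_comp hi
  contr t X :=
    ENNReal.toReal_mono (h𝒜.mat_memLp X.2 (by simp)).2.ne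
      (h𝒜.eLpNorm_matAct_le hstat X.2 _ one_le_two (by simp))
  gen X := by
    have h1 := (h𝒜.tendsto_matGenerator_L2 X.2).comp tendsto_toNNReal_nhdsGT
    have h2 := (ENNReal.tendsto_toReal ENNReal.zero_ne_top).comp h1
    rw [ENNReal.toReal_zero] at h2
    refine h2.congr' ?_
    filter_upwards [self_mem_nhdsWithin] with r (hr : 0 < r)
    simp only [Function.comp_apply, Real.coe_toNNReal r hr.le]
    rfl
  null_mul X Y hX := by
    rw [seminormL2_eq_zero_iff] at hX ⊢
    filter_upwards [hX] with z hz
    rw [Subalgebra.coe_mul, Pi.mul_apply, hz, Pi.zero_apply, zero_mul]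
  mul_null X Y hX := by
    rw [seminormL2_eq_zero_iff] at hX ⊢
    filter_upwards [hX] with z hz
    rw [Subalgebra.coe_mul, Pi.mul_apply, hz, Pi.zero_apply, mul_zero]

/-- The functional `X ↦ E_μ Re tr (W X)`. -/
noncomputable def pairL (h𝒜 : S.IsSuitable μ 𝒜) {W : Ω → Matrix (Fin d) (Fin d) ℂ}
    (hW : MemLp W 2 μ) : matAlgebra 𝒜 d →ₗ[ℝ] ℝ where
  toFun X := ∫ z, (W z * X.1 z).trace.re ∂μ
  map_add' X Y := by
    rw [← integral_add (integrable_traceRe_mul (p := 2) (q := 2) hW (h𝒜.mat_memLp X.2 (by simp)))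
      (integrable_traceRe_mul (p := 2) (q := 2) hW (h𝒜.mat_memLp Y.2 (by simp)))]
    simp only [Subalgebra.coe_add, Pi.add_apply, mul_add, Matrix.trace_add, Complex.add_re]
  map_smul' r X := by
    rw [RingHom.id_apply, smul_eq_mul, ← integral_const_mul]
    simp only [SetLike.val_smul, Pi.smul_apply, Matrix.mul_smul, Matrix.trace_smul,
      Complex.smul_re, smul_eq_mul]

theorem pairL_apply (h𝒜 : S.IsSuitable μ 𝒜) {W : Ω → Matrix (Fin d) (Fin d) ℂ}
    (hW : MemLp W 2 μ) (X : matAlgebra 𝒜 d) :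
    h𝒜.pairL hW X = ∫ z, (W z * X.1 z).trace.re ∂μ := rfl

/-- Hölder with exponents `4`, `2`, `4` for the weight, the `L²` factor and the fixed factor. The
product lies in `L^(4/3)`, where the semigroup also contracts. -/
theorem isProductBounded_pairL (h𝒜 : S.IsSuitable μ 𝒜) (hstat : S.IsStationary μ)
    {W : Ω → Matrix (Fin d) (Fin d) ℂ} (hW : MemLp W 2 μ) (hW4 : MemLp W 4 μ) :
    IsProductBounded (h𝒜.actL d) (h𝒜.seminormL2 d) (h𝒜.pairL hW) := by
  intro Y
  have i1 := holderTriple_two_four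
  have i2 := holderTriple_four_fourThirds
  have i3 : ENNReal.HolderTriple 4 2 (4 / 3) := i1.symm
  have hY4 := (h𝒜.mat_memLp Y.2 (p := 4) (by simp)).2
  have key : ∀ (u : ℝ) (Z : matAlgebra 𝒜 d) (K : ENNReal), K ≠ ⊤ → eLpNorm Z.1 (4 / 3) μ ≤ K →
      |h𝒜.pairL hW (h𝒜.actL d u Z)|
        ≤ ‖traceReCLM d‖ * ((eLpNorm W 4 μ).toReal * K.toReal) := by
    intro u Z K hK hZ
    have hPZ := (h𝒜.actL d u Z).2
    have hb : eLpNorm (W * (h𝒜.actL d u Z).1) 1 μ ≤ eLpNorm W 4 μ * K :=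
      (eLpNorm_matrix_mul_le (p := 4) (q := 4 / 3) hW.1
        (h𝒜.mat_stronglyMeasurable hPZ).aestronglyMeasurable).trans
        (mul_le_mul_right ((h𝒜.eLpNorm_matAct_le hstat Z.2 _ one_le_four_div_three
          (ENNReal.div_ne_top (by simp) (by simp))).trans hZ) _)
    have ht : eLpNorm W 4 μ * K ≠ ⊤ := ENNReal.mul_ne_top hW4.2.ne hK
    have hm : MemLp (W * (h𝒜.actL d u Z).1) 1 μ :=
      ⟨hW.1.mul (h𝒜.mat_stronglyMeasurable hPZ).aestronglyMeasurable, hb.trans_lt ht.lt_top⟩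
    refine (abs_integral_traceRe_le hm).trans (mul_le_mul_of_nonneg_left ?_ (norm_nonneg _))
    rw [← ENNReal.toReal_mul]
    exact ENNReal.toReal_mono ht hb
  refine ⟨‖traceReCLM d‖ * ((eLpNorm W 4 μ).toReal * (eLpNorm Y.1 4 μ).toReal), by positivity,
    fun u v X hu hv => ?_⟩
  have hX2 := (h𝒜.mat_memLp X.2 (p := 2) (by simp)).2
  have hPY : eLpNorm (h𝒜.actL d v Y).1 4 μ ≤ eLpNorm Y.1 4 μ :=
    h𝒜.eLpNorm_matAct_le hstat Y.2 _ (by norm_num) (by simp)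
  have mX := (h𝒜.mat_stronglyMeasurable X.2).aestronglyMeasurable (μ := μ)
  have mY := (h𝒜.mat_stronglyMeasurable (h𝒜.actL d v Y).2).aestronglyMeasurable (μ := μ)
  have e1 := key u (X * h𝒜.actL d v Y) (eLpNorm X.1 2 μ * eLpNorm Y.1 4 μ)
    (ENNReal.mul_ne_top hX2.ne hY4.ne)
    ((eLpNorm_matrix_mul_le (p := 2) (q := 4) mX mY).trans (mul_le_mul_right hPY _))
  have e2 := key u (h𝒜.actL d v Y * X) (eLpNorm Y.1 4 μ * eLpNorm X.1 2 μ)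
    (ENNReal.mul_ne_top hY4.ne hX2.ne)
    ((eLpNorm_matrix_mul_le (p := 4) (q := 2) mY mX).trans (mul_le_mul_left hPY _))
  rw [ENNReal.toReal_mul] at e1 e2
  rw [seminormL2_apply]
  exact ⟨e1.trans_eq (by ring), e2.trans_eq (by ring)⟩

end MarkovSemigroup.IsSuitable

/-! ### Positivity, reversibility and the carré du champ. -/

section QuadraticForm

variable {d : ℕ}

/-- The quadratic form `M ↦ Re ⟨x, M x⟩`, as a continuous linear map in `M`. -/
noncomputable def quadFormCLM (x : Fin d → ℂ) : Matrix (Fin d) (Fin d) ℂ →L[ℝ] ℝ :=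
  LinearMap.toContinuousLinearMap
    { toFun := fun M => (star x ⬝ᵥ M.mulVec x).re
      map_add' := fun M M' => by
        rw [Matrix.add_mulVec, dotProduct_add, Complex.add_re]
      map_smul' := fun r M => by
        rw [Matrix.smul_mulVec, dotProduct_smul, Complex.smul_re, RingHom.id_apply] }

theorem Matrix.IsHermitian.posSemidef_of_quadFormCLM {M : Matrix (Fin d) (Fin d) ℂ}
    (hM : M.IsHermitian) (h : ∀ x, 0 ≤ quadFormCLM x M) : M.PosSemidef := by
  refine Matrix.PosSemidef.of_dotProduct_mulVec_nonneg hM fun x => ?_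
  rw [Complex.nonneg_iff]
  exact ⟨h x, (hM.im_star_dotProduct_mulVec_self x).symm⟩

theorem Matrix.PosSemidef.quadFormCLM_nonneg {M : Matrix (Fin d) (Fin d) ℂ}
    (hM : M.PosSemidef) (x : Fin d → ℂ) : 0 ≤ quadFormCLM x M :=
  (Complex.nonneg_iff.1 (hM.dotProduct_mulVec_nonneg x)).1

theorem Matrix.IsHermitian.posSemidef_mul_self {M : Matrix (Fin d) (Fin d) ℂ}
    (hM : M.IsHermitian) : (M * M).PosSemidef := by
  have := Matrix.posSemidef_conjTranspose_mul_self M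
  rwa [hM.eq] at this

theorem isClosed_isHermitian : IsClosed {M : Matrix (Fin d) (Fin d) ℂ | M.IsHermitian} := by
  have h : Continuous fun A : Matrix (Fin d) (Fin d) ℂ => A.conjTranspose :=
    continuous_id.matrix_conjTranspose
  exact isClosed_eq h continuous_id

end QuadraticForm

theorem matExpect_isHermitian {Ω : Type*} [MeasurableSpace Ω] {d : ℕ} {ν : Measure Ω}
    {X : Ω → Matrix (Fin d) (Fin d) ℂ} (hX : ∀ z, (X z).IsHermitian) :
    (matExpect ν X).IsHermitian := by
  refine Matrix.IsHermitian.ext fun i j => ?_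
  change (starRingEnd ℂ) (∫ y, X y j i ∂ν) = ∫ y, X y i j ∂ν
  rw [← integral_conj]
  exact integral_congr_ae (Eventually.of_forall fun y => (hX y).apply i j)

theorem memLp_of_norm_le_rpow {Ω E F : Type*} [MeasurableSpace Ω] {μ : Measure Ω}
    [IsFiniteMeasure μ] [NormedAddCommGroup E] [NormedAddCommGroup F] {X : Ω → E} {Y : Ω → F}
    (hX : ∀ p : ENNReal, p ≠ ⊤ → MemLp X p μ) (hY : AEStronglyMeasurable Y μ) {C r : ℝ}
    (hr : 0 ≤ r) (h : ∀ z, ‖Y z‖ ≤ C * ‖X z‖ ^ r) {p : ENNReal} (hp : p ≠ ⊤) : MemLp Y p μ := by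
  rcases hr.eq_or_lt with rfl | hr
  · refine MemLp.of_bound hY C (Eventually.of_forall fun z => ?_)
    simpa using h z
  · have hr0 : ENNReal.ofReal r ≠ 0 := by simpa using hr
    have h1 := (hX (p * ENNReal.ofReal r) (ENNReal.mul_ne_top hp ENNReal.ofReal_ne_top)).norm_rpow_div
      (ENNReal.ofReal r)
    rw [ENNReal.mul_div_cancel_right hr0 ENNReal.ofReal_ne_top, ENNReal.toReal_ofReal hr.le] at h1
    refine h1.of_le_mul (c := C) hY (Eventually.of_forall fun z => ?_)
    rw [Real.norm_of_nonneg (by positivity)]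
    exact h z

theorem holderTriple_four_four : ENNReal.HolderTriple 4 4 2 := by
  constructor
  rw [← ENNReal.toReal_eq_toReal_iff' (by simp) (by simp), ENNReal.toReal_add (by simp) (by simp)]
  norm_num

namespace MarkovSemigroup

variable {Ω : Type*} [MeasurableSpace Ω] {S : MarkovSemigroup Ω} {μ : Measure Ω}
  {𝒜 : Subalgebra ℝ (Ω → ℝ)} {d : ℕ}

theorem matAct_isHermitian {X : Ω → Matrix (Fin d) (Fin d) ℂ}
    (hX : ∀ z, (X z).IsHermitian) (t : NNReal) (z : Ω) : (S.matAct t X z).IsHermitian :=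
  matExpect_isHermitian hX

/-- Self-adjointness tested on indicators says that the law of `(Z_0, Z_t)` is symmetric on
rectangles, and these determine it. -/
theorem IsReversible.measurePreserving_swap [IsProbabilityMeasure μ]
    (hrev : S.IsReversible μ) (t : NNReal) :
    MeasurePreserving Prod.swap (μ ⊗ₘ S.kernel t) (μ ⊗ₘ S.kernel t) := by
  have := S.isMarkov t
  refine ⟨measurable_swap, Measure.ext_prod fun {s u} hs hu => ?_⟩
  rw [Measure.map_apply measurable_swap (hs.prod hu), Set.preimage_swap_prod,
    Measure.compProd_apply_prod hu hs, Measure.compProd_apply_prod hs hu]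
  have key : ∀ a b : Set Ω, MeasurableSet a → MeasurableSet b →
      ∫⁻ x in a, S.kernel t x b ∂μ = ENNReal.ofReal (∫ x, a.indicator (fun _ => (1 : ℝ)) x
        * S.act t (b.indicator fun _ => (1 : ℝ)) x ∂μ) := by
    intro a b ha hb
    have e1 : ∀ x, S.act t (b.indicator fun _ => (1 : ℝ)) x = (S.kernel t x).real b := fun x => by
      rw [act, integral_indicator_const _ hb, smul_eq_mul, mul_one]
    have e2 : ∀ x, a.indicator (fun _ => (1 : ℝ)) x * S.act t (b.indicator fun _ => (1 : ℝ)) x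
        = a.indicator (fun x => (S.kernel t x).real b) x := fun x => by
      rw [e1]; by_cases hx : x ∈ a <;> simp [hx]
    simp only [e2]
    rw [integral_indicator ha, ofReal_integral_eq_lintegral_ofReal]
    · refine lintegral_congr fun x => ?_
      rw [Measure.real, ENNReal.ofReal_toReal (measure_ne_top _ _)]
    · refine Integrable.of_bound ?_ 1 (Eventually.of_forall fun x => ?_)
      · exact ((S.kernel t).measurable_coe hb).ennreal_toReal.aestronglyMeasurable
      · rw [Real.norm_of_nonneg measureReal_nonneg]
        exact measureReal_le_one
    · exact Eventually.of_forall fun x => measureReal_nonneg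
  rw [key _ _ hu hs, key _ _ hs hu]
  congr 1
  have hm (b : Set Ω) (hb : MeasurableSet b) :
      MemLp (b.indicator fun _ => (1 : ℝ)) 2 μ := (memLp_const (1 : ℝ)).indicator hb
  rw [← hrev t _ _ (hm u hu) (hm s hs)]
  exact integral_congr_ae (Eventually.of_forall fun x => mul_comm _ _)

namespace IsSuitable

variable (h𝒜 : S.IsSuitable μ 𝒜)
include h𝒜

theorem integral_sq_sub {X : Ω → Matrix (Fin d) (Fin d) ℂ} (hX : X ∈ matAlgebra 𝒜 d)
    (t : NNReal) (z : Ω) : ∫ y, (X y - X z) * (X y - X z) ∂S.kernel t z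
      = S.matAct t (X * X) z - X z * S.matAct t X z - S.matAct t X z * X z + X z * X z := by
  have := S.isMarkov t
  have i1 := h𝒜.mat_integrable hX t z
  have i2 : Integrable (fun y => X y * X y) (S.kernel t z) :=
    h𝒜.mat_integrable (Subalgebra.mul_mem _ hX hX) t z
  have i3 : Integrable (fun y => X z * X y) (S.kernel t z) := i1.const_mul' (X z)
  have i4 : Integrable (fun y => X y * X z) (S.kernel t z) := i1.mul_const' (X z)
  have i5 : Integrable (fun y => X y * X y - X z * X y) (S.kernel t z) := i2.sub i3
  have i6 : Integrable (fun y => X y * X y - X z * X y - X y * X z) (S.kernel t z) := i5.sub i4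
  have e : ∀ y, (X y - X z) * (X y - X z) = X y * X y - X z * X y - X y * X z + X z * X z :=
    fun y => by noncomm_ring
  simp only [e]
  rw [integral_add i6 (integrable_const _), integral_sub i5 i4,
    integral_sub i2 i3, integral_const, probReal_univ, one_smul,
    h𝒜.matAct_eq_integral (Subalgebra.mul_mem _ hX hX), h𝒜.matAct_eq_integral hX]
  congr 3
  · exact (ContinuousLinearMap.mul ℝ _ (X z)).integral_comp_comm i1
  · exact ((ContinuousLinearMap.mul ℝ (Matrix (Fin d) (Fin d) ℂ)).flip (X z)).integral_comp_comm i1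

theorem integrable_sq_sub {X : Ω → Matrix (Fin d) (Fin d) ℂ} (hX : X ∈ matAlgebra 𝒜 d)
    (t : NNReal) (z : Ω) : Integrable (fun y => (X y - X z) * (X y - X z)) (S.kernel t z) := by
  have := S.isMarkov t
  have h := h𝒜.mat_integrable (Subalgebra.mul_mem _
    (Subalgebra.sub_mem _ hX (const_mem_matAlgebra (X z)))
    (Subalgebra.sub_mem _ hX (const_mem_matAlgebra (X z)))) t z
  exact h

/-- `Γ` as the rate of mean squared increments. Positivity and invariance under subtracting a
constant can be read off from this form. -/
theorem tendsto_Gamma {X : Ω → Matrix (Fin d) (Fin d) ℂ} (hX : X ∈ matAlgebra 𝒜 d) (z : Ω) :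
    Tendsto (fun t : NNReal => (1 / 2 : ℝ) • ((t : ℝ)⁻¹ •
      ∫ y, (X y - X z) * (X y - X z) ∂S.kernel t z)) (𝓝[>] 0) (𝓝 (S.Gamma X X z)) := by
  have h1 := h𝒜.tendsto_matGenerator (Subalgebra.mul_mem _ hX hX) z
  have h2 := h𝒜.tendsto_matGenerator hX z
  have h3 := ((h1.sub (h2.const_mul (X z))).sub (h2.mul_const (X z))).const_smul (1 / 2 : ℝ)
  refine h3.congr fun t => ?_
  rw [h𝒜.integral_sq_sub hX]
  congr 1
  simp only [Pi.mul_apply, mul_sub, sub_mul, smul_sub, smul_add, mul_smul_comm, smul_mul_assoc]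
  abel

theorem Gamma_sub_const {X : Ω → Matrix (Fin d) (Fin d) ℂ} (hX : X ∈ matAlgebra 𝒜 d)
    (M : Matrix (Fin d) (Fin d) ℂ) :
    S.Gamma (fun z => X z - M) (fun z => X z - M) = S.Gamma X X := by
  funext z
  have h := h𝒜.tendsto_Gamma (Subalgebra.sub_mem _ hX (const_mem_matAlgebra M)) z
  refine tendsto_nhds_unique h ((h𝒜.tendsto_Gamma hX z).congr fun t => ?_)
  simp only [Pi.sub_apply, sub_sub_sub_cancel_right]

theorem Gamma_mem {X Y : Ω → Matrix (Fin d) (Fin d) ℂ} (hX : X ∈ matAlgebra 𝒜 d)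
    (hY : Y ∈ matAlgebra 𝒜 d) : S.Gamma X Y ∈ matAlgebra 𝒜 d :=
  Subalgebra.smul_mem _ (Subalgebra.sub_mem _ (Subalgebra.sub_mem _
    (h𝒜.matGenerator_mem (Subalgebra.mul_mem _ hX hY))
    (Subalgebra.mul_mem _ hX (h𝒜.matGenerator_mem hY)))
    (Subalgebra.mul_mem _ (h𝒜.matGenerator_mem hX) hY)) _

theorem matAct_isSuitableMat {X : Ω → Matrix (Fin d) (Fin d) ℂ} (hX : IsSuitableMat 𝒜 X)
    (t : NNReal) : IsSuitableMat 𝒜 (S.matAct t X) where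
  isHermitian := matAct_isHermitian hX.isHermitian t
  re_mem i j := (h𝒜.matAct_mem hX.mem t i j).1
  im_mem i j := (h𝒜.matAct_mem hX.mem t i j).2

theorem Gamma_posSemidef {X : Ω → Matrix (Fin d) (Fin d) ℂ} (hX : IsSuitableMat 𝒜 X) (z : Ω) :
    (S.Gamma X X z).PosSemidef := by
  have hD : ∀ y, ((X y - X z) * (X y - X z)).PosSemidef := fun y =>
    ((hX.isHermitian y).sub (hX.isHermitian z)).posSemidef_mul_self
  have hlim := h𝒜.tendsto_Gamma hX.mem z
  have hH : (S.Gamma X X z).IsHermitian := by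
    refine isClosed_isHermitian.mem_of_tendsto hlim (Eventually.of_forall fun t => ?_)
    have h1 : (∫ y, (X y - X z) * (X y - X z) ∂S.kernel t z).IsHermitian := by
      have h := matAct_isHermitian (S := S) (X := fun y => (X y - X z) * (X y - X z))
        (fun y => (hD y).isHermitian) t z
      have e : S.matAct t (fun y => (X y - X z) * (X y - X z)) z
          = ∫ y, (X y - X z) * (X y - X z) ∂S.kernel t z :=
        matExpect_eq_integral (h𝒜.integrable_sq_sub hX.mem t z)
      rwa [e] at h
    rw [Set.mem_ofPred_eq, Matrix.IsHermitian, Matrix.conjTranspose_smul,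
      Matrix.conjTranspose_smul, h1.eq, star_trivial, star_trivial]
  refine hH.posSemidef_of_quadFormCLM fun x => ?_
  refine ge_of_tendsto' (((quadFormCLM x).continuous.tendsto _).comp hlim) fun t => ?_
  rw [Function.comp_apply, map_smul, map_smul,
    ← (quadFormCLM x).integral_comp_comm (h𝒜.integrable_sq_sub hX.mem t z)]
  exact smul_nonneg (by norm_num) (smul_nonneg (by positivity)
    (integral_nonneg fun y => (hD y).quadFormCLM_nonneg x))

end IsSuitable

end MarkovSemigroup

/-! ### The Dirichlet form as an expectation over the stationary pair. -/

namespace MarkovSemigroup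

variable {Ω : Type*} [MeasurableSpace Ω] {S : MarkovSemigroup Ω} {μ : Measure Ω}
  [IsProbabilityMeasure μ] {𝒜 : Subalgebra ℝ (Ω → ℝ)} {d : ℕ}

theorem measurePreserving_fst (S : MarkovSemigroup Ω) (t : NNReal) :
    MeasurePreserving Prod.fst (μ ⊗ₘ S.kernel t) μ := by
  have := S.isMarkov t
  exact ⟨measurable_fst, Measure.fst_compProd μ (S.kernel t)⟩

theorem IsStationary.measurePreserving_snd (hstat : S.IsStationary μ) (t : NNReal) :
    MeasurePreserving Prod.snd (μ ⊗ₘ S.kernel t) μ := by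
  have := S.isMarkov t
  exact ⟨measurable_snd, (Measure.snd_compProd μ (S.kernel t)).trans (hstat t).def⟩

omit [IsProbabilityMeasure μ] in
theorem integral_comp_of_measurePreserving {Ω' : Type*} [MeasurableSpace Ω'] {π : Measure Ω'}
    {p : Ω' → Ω} (hp : MeasurePreserving p π μ) {a : Ω → ℝ} (ha : AEStronglyMeasurable a μ) :
    ∫ x, a (p x) ∂π = ∫ z, a z ∂μ := by
  have := integral_map (μ := π) hp.measurable.aemeasurable (f := a) (by rwa [hp.map_eq])
  rw [← this, hp.map_eq]

theorem IsReversible.integral_swap (hrev : S.IsReversible μ) (t : NNReal) (a : Ω × Ω → ℝ) :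
    ∫ p, a p.swap ∂(μ ⊗ₘ S.kernel t) = ∫ p, a p ∂(μ ⊗ₘ S.kernel t) :=
  (hrev.measurePreserving_swap t).integral_comp
    (MeasurableEquiv.prodComm (α := Ω) (β := Ω)).measurableEmbedding a

theorem trace_mul_re_comm (A B : Matrix (Fin d) (Fin d) ℂ) :
    (A * B).trace.re = (B * A).trace.re := by rw [Matrix.trace_mul_comm]

namespace IsSuitable

section Pair

variable {W : Ω → Matrix (Fin d) (Fin d) ℂ}

theorem integral_traceRe_mul (A : Matrix (Fin d) (Fin d) ℂ) {ν : Measure Ω}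
    {F : Ω → Matrix (Fin d) (Fin d) ℂ} (hF : Integrable F ν) :
    ∫ y, (A * F y).trace.re ∂ν = (A * ∫ y, F y ∂ν).trace.re :=
  ((traceReCLM d).comp
    (ContinuousLinearMap.mul ℝ (Matrix (Fin d) (Fin d) ℂ) A)).integral_comp_comm hF

theorem pairL_actL (h𝒜 : S.IsSuitable μ 𝒜) (hstat : S.IsStationary μ) (hW : MemLp W 2 μ)
    (t : ℝ) (Z : matAlgebra 𝒜 d) :
    h𝒜.pairL hW (h𝒜.actL d t Z)
      = ∫ p, (W p.1 * Z.1 p.2).trace.re ∂(μ ⊗ₘ S.kernel t.toNNReal) := by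
  have := S.isMarkov t.toNNReal
  have hi : Integrable (fun p : Ω × Ω => (W p.1 * Z.1 p.2).trace.re)
      (μ ⊗ₘ S.kernel t.toNNReal) := integrable_traceRe_mul (p := 2) (q := 2)
    (hW.comp_measurePreserving (S.measurePreserving_fst _))
    ((h𝒜.mat_memLp Z.2 (by simp)).comp_measurePreserving (hstat.measurePreserving_snd _))
  rw [Measure.integral_compProd hi, pairL_apply]
  refine integral_congr_ae (Eventually.of_forall fun z => ?_)
  simp only [actL_apply]
  exact (integral_traceRe_mul _ (h𝒜.mat_integrable Z.2 _ z)).symm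

theorem pairL_actL_nonneg (h𝒜 : S.IsSuitable μ 𝒜) (hstat : S.IsStationary μ) (hW : MemLp W 2 μ)
    (hpos : ∀ z A, A.PosSemidef → 0 ≤ (W z * A).trace.re) (t : ℝ) (Z : matAlgebra 𝒜 d)
    (hZ : ∀ᵐ z ∂μ, (Z.1 z).PosSemidef) : 0 ≤ h𝒜.pairL hW (h𝒜.actL d t Z) := by
  rw [h𝒜.pairL_actL hstat]
  refine integral_nonneg_of_ae ?_
  filter_upwards [(hstat.measurePreserving_snd t.toNNReal).quasiMeasurePreserving.ae hZ] with p hp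
  exact hpos _ _ hp

/-- Expand the product of increments: stationarity makes the two diagonal terms equal, reversibility
the two cross terms. -/
theorem neg_pairL_actL_sub (h𝒜 : S.IsSuitable μ 𝒜) (hstat : S.IsStationary μ)
    (hrev : S.IsReversible μ) (hW : MemLp W 2 μ) (t : ℝ) (Z : matAlgebra 𝒜 d) :
    -h𝒜.pairL hW (h𝒜.actL d t Z - Z) = 1 / 2 *
      ∫ p, ((Z.1 p.2 - Z.1 p.1) * (W p.2 - W p.1)).trace.re ∂(μ ⊗ₘ S.kernel t.toNNReal) := by
  set π := μ ⊗ₘ S.kernel t.toNNReal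
  have hZ : MemLp Z.1 2 μ := h𝒜.mat_memLp Z.2 (by simp)
  have mp1 := S.measurePreserving_fst (μ := μ) t.toNNReal
  have mp2 := hstat.measurePreserving_snd t.toNNReal
  have Z1 := hZ.comp_measurePreserving mp1
  have Z2 := hZ.comp_measurePreserving mp2
  have W1 := hW.comp_measurePreserving mp1
  have W2 := hW.comp_measurePreserving mp2
  have i22 : Integrable (fun p => (Z.1 p.2 * W p.2).trace.re) π :=
    integrable_traceRe_mul (p := 2) (q := 2) Z2 W2
  have i21 : Integrable (fun p => (Z.1 p.2 * W p.1).trace.re) π :=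
    integrable_traceRe_mul (p := 2) (q := 2) Z2 W1
  have i12 : Integrable (fun p => (Z.1 p.1 * W p.2).trace.re) π :=
    integrable_traceRe_mul (p := 2) (q := 2) Z1 W2
  have i11 : Integrable (fun p => (Z.1 p.1 * W p.1).trace.re) π :=
    integrable_traceRe_mul (p := 2) (q := 2) Z1 W1
  have e : ∀ p : Ω × Ω, ((Z.1 p.2 - Z.1 p.1) * (W p.2 - W p.1)).trace.re
      = (Z.1 p.2 * W p.2).trace.re + (Z.1 p.1 * W p.1).trace.re
        - ((Z.1 p.2 * W p.1).trace.re + (Z.1 p.1 * W p.2).trace.re) := fun p => by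
    simp only [mul_sub, sub_mul, Matrix.trace_sub, Complex.sub_re]; ring
  have hm := integrable_traceRe_mul (p := 2) (q := 2) hZ hW
  have h22 : ∫ p, (Z.1 p.2 * W p.2).trace.re ∂π = ∫ z, (Z.1 z * W z).trace.re ∂μ :=
    integral_comp_of_measurePreserving mp2 hm.1
  have h11 : ∫ p, (Z.1 p.1 * W p.1).trace.re ∂π = ∫ z, (Z.1 z * W z).trace.re ∂μ :=
    integral_comp_of_measurePreserving mp1 hm.1
  have h12 : ∫ p, (Z.1 p.1 * W p.2).trace.re ∂π = ∫ p, (Z.1 p.2 * W p.1).trace.re ∂π :=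
    hrev.integral_swap t.toNNReal fun p => (Z.1 p.2 * W p.1).trace.re
  have h21 : ∫ p, (Z.1 p.2 * W p.1).trace.re ∂π = h𝒜.pairL hW (h𝒜.actL d t Z) := by
    rw [h𝒜.pairL_actL hstat]
    exact integral_congr_ae (Eventually.of_forall fun p => trace_mul_re_comm _ _)
  have h0 : ∫ z, (Z.1 z * W z).trace.re ∂μ = h𝒜.pairL hW Z :=
    integral_congr_ae (Eventually.of_forall fun p => trace_mul_re_comm _ _)
  simp only [e]
  have iA : Integrable (fun p => (Z.1 p.2 * W p.2).trace.re + (Z.1 p.1 * W p.1).trace.re) π :=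
    i22.add i11
  have iB : Integrable (fun p => (Z.1 p.2 * W p.1).trace.re + (Z.1 p.1 * W p.2).trace.re) π :=
    i21.add i12
  rw [integral_sub iA iB, integral_add i22 i11, integral_add i21 i12,
    h22, h11, h12, h21, h0, map_sub]
  ring

theorem integrable_sq_sub_mul (h𝒜 : S.IsSuitable μ 𝒜) (hstat : S.IsStationary μ)
    (hW : MemLp W 2 μ) (t : NNReal) (Z : matAlgebra 𝒜 d) :
    Integrable (fun p : Ω × Ω => ((Z.1 p.2 - Z.1 p.1) * (Z.1 p.2 - Z.1 p.1) * W p.1).trace.re)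
      (μ ⊗ₘ S.kernel t) := by
  have hZ : MemLp Z.1 4 μ := h𝒜.mat_memLp Z.2 (by simp)
  have mp1 := S.measurePreserving_fst (μ := μ) t
  have mp2 := hstat.measurePreserving_snd t
  have hD : MemLp (fun p : Ω × Ω => Z.1 p.2 - Z.1 p.1) 4 (μ ⊗ₘ S.kernel t) :=
    (hZ.comp_measurePreserving mp2).sub (hZ.comp_measurePreserving mp1)
  have := holderTriple_four_four
  have hD2 : MemLp (fun p : Ω × Ω => (Z.1 p.2 - Z.1 p.1) * (Z.1 p.2 - Z.1 p.1)) 2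
      (μ ⊗ₘ S.kernel t) :=
    ⟨hD.1.mul hD.1, (eLpNorm_matrix_mul_le (p := 4) (q := 4) hD.1 hD.1).trans_lt
      (ENNReal.mul_lt_top hD.2 hD.2)⟩
  exact integrable_traceRe_mul (p := 2) (q := 2) hD2 (hW.comp_measurePreserving mp1)

theorem integral_sq_sub_mul (h𝒜 : S.IsSuitable μ 𝒜) (hstat : S.IsStationary μ)
    (hW : MemLp W 2 μ) (t : ℝ) (Z : matAlgebra 𝒜 d) :
    ∫ p, ((Z.1 p.2 - Z.1 p.1) * (Z.1 p.2 - Z.1 p.1) * W p.1).trace.re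
        ∂(μ ⊗ₘ S.kernel t.toNNReal)
      = h𝒜.pairL hW (h𝒜.actL d t (Z * Z) - Z * h𝒜.actL d t Z - h𝒜.actL d t Z * Z + Z * Z) := by
  have := S.isMarkov t.toNNReal
  rw [Measure.integral_compProd (h𝒜.integrable_sq_sub_mul hstat hW _ Z), pairL_apply]
  refine integral_congr_ae (Eventually.of_forall fun z => ?_)
  have h := h𝒜.integral_sq_sub Z.2 t.toNNReal z
  have h2 := integral_traceRe_mul (W z) (h𝒜.integrable_sq_sub Z.2 t.toNNReal z)
  rw [h] at h2
  refine Eq.trans ?_ h2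
  exact integral_congr_ae (Eventually.of_forall fun p => trace_mul_re_comm _ _)

end Pair

/-- The mean value inequality for the Dirichlet form. -/
theorem neg_pairL_genL_le (h𝒜 : S.IsSuitable μ 𝒜) (hstat : S.IsStationary μ)
    (hrev : S.IsReversible μ) {F G : matAlgebra 𝒜 d} (hF : ∀ z, (F.1 z).IsHermitian)
    (hG : ∀ z, (G.1 z).IsHermitian) {φ ψ : ℝ → ℝ}
    (hφ : ∀ a b, |φ a - φ b| ≤ |a - b| * ((ψ a + ψ b) / 2)) (hψ : ∀ a, 0 ≤ ψ a)
    (hΦ : MemLp (fun z => cfc φ (F.1 z)) 2 μ) (hΨ : MemLp (fun z => cfc ψ (F.1 z)) 2 μ)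
    (hΦ4 : MemLp (fun z => cfc φ (F.1 z)) 4 μ) (hΨ4 : MemLp (fun z => cfc ψ (F.1 z)) 4 μ)
    {τ : ℝ} (hτ : 0 < τ) :
    -h𝒜.pairL hΦ (h𝒜.genL d G) ≤ 1 / 4 * (τ * h𝒜.pairL hΨ (dblGamma (h𝒜.genL d) F F)
      + τ⁻¹ * h𝒜.pairL hΨ (dblGamma (h𝒜.genL d) G G)) := by
  have H := h𝒜.isContractionCalculus hstat d
  have bΦ := h𝒜.isProductBounded_pairL hstat hΦ hΦ4
  have bΨ := h𝒜.isProductBounded_pairL hstat hΨ hΨ4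
  have l1 := ((bΦ.tendsto_of_null H (H.gen G)).add_const (h𝒜.pairL hΦ (h𝒜.genL d G))).neg
  rw [zero_add] at l1
  have l2 := (((bΨ.tendsto_dblGamma H F).const_mul τ).add
    ((bΨ.tendsto_dblGamma H G).const_mul τ⁻¹)).const_mul (1 / 4)
  refine le_of_tendsto_of_tendsto l1 l2 ?_
  filter_upwards [self_mem_nhdsWithin] with h (hh : 0 < h)
  set π := μ ⊗ₘ S.kernel h.toNNReal with hπ
  have iF := h𝒜.integrable_sq_sub_mul hstat hΨ h.toNNReal F
  have iG := h𝒜.integrable_sq_sub_mul hstat hΨ h.toNNReal G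
  have sw (Z : matAlgebra 𝒜 d) (p : Ω × Ω) :
      ((Z.1 p.1 - Z.1 p.2) * (Z.1 p.1 - Z.1 p.2) * cfc ψ (F.1 p.2)).trace.re
        = ((Z.1 p.2 - Z.1 p.1) * (Z.1 p.2 - Z.1 p.1) * cfc ψ (F.1 p.2)).trace.re := by
    rw [← neg_sub (Z.1 p.2), neg_mul_neg]
  have iS (Z : matAlgebra 𝒜 d) : Integrable (fun p : Ω × Ω =>
      ((Z.1 p.2 - Z.1 p.1) * (Z.1 p.2 - Z.1 p.1) * cfc ψ (F.1 p.2)).trace.re) π := by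
    have := (hrev.measurePreserving_swap h.toNNReal).integrable_comp_of_integrable
      (h𝒜.integrable_sq_sub_mul hstat hΨ h.toNNReal Z)
    exact this.congr (Eventually.of_forall fun p => sw Z p)
  -- Exchanging the endpoints moves the weight from `p.2` to `p.1` and leaves the squared increment
  -- unchanged.
  have hS (Z : matAlgebra 𝒜 d) : ∫ p : Ω × Ω,
      ((Z.1 p.2 - Z.1 p.1) * (Z.1 p.2 - Z.1 p.1) * cfc ψ (F.1 p.2)).trace.re ∂π
      = ∫ p : Ω × Ω, ((Z.1 p.2 - Z.1 p.1) * (Z.1 p.2 - Z.1 p.1) * cfc ψ (F.1 p.1)).trace.re ∂π := by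
    refine (integral_congr_ae (Eventually.of_forall fun p => (sw Z p).symm)).trans ?_
    exact hrev.integral_swap h.toNNReal
      fun p => ((Z.1 p.2 - Z.1 p.1) * (Z.1 p.2 - Z.1 p.1) * cfc ψ (F.1 p.1)).trace.re
  have hbound : ∫ p, ((G.1 p.2 - G.1 p.1) * (cfc φ (F.1 p.2) - cfc φ (F.1 p.1))).trace.re ∂π
      ≤ 1 / 2 * (τ * ∫ p, ((F.1 p.2 - F.1 p.1) * (F.1 p.2 - F.1 p.1)
          * cfc ψ (F.1 p.1)).trace.re ∂π
        + τ⁻¹ * ∫ p, ((G.1 p.2 - G.1 p.1) * (G.1 p.2 - G.1 p.1)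
          * cfc ψ (F.1 p.1)).trace.re ∂π) := by
    have h1 : ∫ p, ((G.1 p.2 - G.1 p.1) * (cfc φ (F.1 p.2) - cfc φ (F.1 p.1))).trace.re ∂π
        ≤ ∫ p : Ω × Ω, 1 / 4 * (τ * (((F.1 p.2 - F.1 p.1) * (F.1 p.2 - F.1 p.1)
            * cfc ψ (F.1 p.2)).trace.re
          + ((F.1 p.2 - F.1 p.1) * (F.1 p.2 - F.1 p.1) * cfc ψ (F.1 p.1)).trace.re)
          + τ⁻¹ * (((G.1 p.2 - G.1 p.1) * (G.1 p.2 - G.1 p.1) * cfc ψ (F.1 p.2)).trace.re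
          + ((G.1 p.2 - G.1 p.1) * (G.1 p.2 - G.1 p.1) * cfc ψ (F.1 p.1)).trace.re)) ∂π := by
      have mp1 := S.measurePreserving_fst (μ := μ) h.toNNReal
      have mp2 := hstat.measurePreserving_snd h.toNNReal
      have hG2 : MemLp G.1 2 μ := h𝒜.mat_memLp G.2 (by simp)
      refine integral_mono (integrable_traceRe_mul (p := 2) (q := 2)
        ((hG2.comp_measurePreserving mp2).sub (hG2.comp_measurePreserving mp1))
        ((hΦ.comp_measurePreserving mp2).sub (hΦ.comp_measurePreserving mp1)))
        (((((iS F).add iF).const_mul τ).add (((iS G).add iG).const_mul τ⁻¹)).const_mul (1 / 4))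
        fun p => ?_
      exact re_trace_mul_cfc_sub_le (hF p.2) (hF p.1) ((hG p.2).sub (hG p.1)) hφ hψ hτ
    refine h1.trans_eq ?_
    have iA (Z : matAlgebra 𝒜 d) (r : ℝ) : Integrable (fun p : Ω × Ω =>
        r * (((Z.1 p.2 - Z.1 p.1) * (Z.1 p.2 - Z.1 p.1) * cfc ψ (F.1 p.2)).trace.re
          + ((Z.1 p.2 - Z.1 p.1) * (Z.1 p.2 - Z.1 p.1) * cfc ψ (F.1 p.1)).trace.re)) π :=
      ((iS Z).add (h𝒜.integrable_sq_sub_mul hstat hΨ h.toNNReal Z)).const_mul r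
    rw [integral_const_mul, integral_add (iA F τ) (iA G τ⁻¹), integral_const_mul, integral_const_mul,
      integral_add (iS F) iF, integral_add (iS G) iG, hS F, hS G]
    ring
  have hn := h𝒜.neg_pairL_actL_sub hstat hrev hΦ h G
  have hF' := h𝒜.integral_sq_sub_mul hstat hΨ h F
  have hG' := h𝒜.integral_sq_sub_mul hstat hΨ h G
  rw [← hπ] at hn hF' hG'
  rw [hF', hG'] at hbound
  rw [map_sub, sub_add_cancel, map_smul, smul_eq_mul, ← mul_neg, hn]
  have := mul_le_mul_of_nonneg_left hbound (inv_pos.2 hh).le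
  linarith

end IsSuitable

end MarkovSemigroup

/-! ### The moment inequality for functions of mean zero. -/

section ScalarFunctions

variable {q : ℝ}

theorem continuous_mul_abs_rpow (hq : 1 ≤ q) :
    Continuous fun x : ℝ => x * |x| ^ (2 * q - 2) :=
  continuous_id.mul (continuous_abs.rpow_const fun _ => Or.inr (by linarith))

theorem continuous_const_mul_abs_rpow (hq : 1 ≤ q) :
    Continuous fun x : ℝ => (2 * q - 1) * |x| ^ (2 * q - 2) :=
  continuous_const.mul (continuous_abs.rpow_const fun _ => Or.inr (by linarith))

theorem continuous_abs_rpow (hq : 1 ≤ q) : Continuous fun x : ℝ => |x| ^ (2 * q) :=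
  continuous_abs.rpow_const fun _ => Or.inr (by linarith)

theorem abs_mul_abs_rpow (hq : 1 ≤ q) (x : ℝ) :
    |x * |x| ^ (2 * q - 2)| ≤ 1 * |x| ^ (2 * q - 1) := by
  rw [abs_mul, abs_of_nonneg (Real.rpow_nonneg (abs_nonneg x) _), one_mul,
    show 2 * q - 1 = 1 + (2 * q - 2) by ring,
    Real.rpow_add_of_nonneg (abs_nonneg _) zero_le_one (by linarith), Real.rpow_one]

end ScalarFunctions

theorem specNorm_eq_norm {d : ℕ} (A : Matrix (Fin d) (Fin d) ℂ) : specNorm A = ‖A‖ := rfl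

theorem Matrix.PosSemidef.re_trace_cfc_rpow_nonneg {d : ℕ} {A : Matrix (Fin d) (Fin d) ℂ}
    (hA : A.PosSemidef) (q : ℝ) : 0 ≤ (cfc (fun x : ℝ => x ^ q) A).trace.re := by
  rw [re_trace_cfc hA.isHermitian]
  exact Finset.sum_nonneg fun i _ => Real.rpow_nonneg (hA.eigenvalues_nonneg i) q

theorem Matrix.PosSemidef.re_trace_cfc_rpow_le {d : ℕ} {A : Matrix (Fin d) (Fin d) ℂ}
    (hA : A.PosSemidef) {q v : ℝ} (hq : 0 ≤ q) (hv : ‖A‖ ≤ v) :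
    (cfc (fun x : ℝ => x ^ q) A).trace.re ≤ d * v ^ q := by
  rw [re_trace_cfc hA.isHermitian]
  refine (Finset.sum_le_card_nsmul _ _ (v ^ q) fun i _ => ?_).trans_eq (by simp)
  refine Real.rpow_le_rpow (hA.eigenvalues_nonneg i) ((le_abs_self _).trans
    ((hA.isHermitian.norm_le_of_mem_spectrum ?_).trans hv)) hq
  exact hA.isHermitian.eigenvalues_mem_spectrum_real i

namespace MarkovSemigroup

variable {Ω : Type*} [MeasurableSpace Ω] {S : MarkovSemigroup Ω} {μ : Measure Ω}
  {𝒜 : Subalgebra ℝ (Ω → ℝ)} {d : ℕ}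

namespace IsSuitable

theorem dblGamma_genL (h𝒜 : S.IsSuitable μ 𝒜) (X Y : matAlgebra 𝒜 d) :
    (dblGamma (h𝒜.genL d) X Y).1 = (2 : ℝ) • S.Gamma X.1 Y.1 := by
  have h : S.Gamma X.1 Y.1 = (1 / 2 : ℝ) • (dblGamma (h𝒜.genL d) X Y).1 := rfl
  rw [h, smul_smul]
  norm_num

theorem quadGamma₂_genL (h𝒜 : S.IsSuitable μ 𝒜) (X : matAlgebra 𝒜 d) :
    (quadGamma₂ (h𝒜.genL d) X).1 = (4 : ℝ) • S.Gamma₂ X.1 X.1 := by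
  have e : S.matGenerator (S.Gamma X.1 X.1)
      = (1 / 2 : ℝ) • (h𝒜.genL d (dblGamma (h𝒜.genL d) X X)).1 :=
    congrArg Subtype.val (map_smul (h𝒜.genL d) (1 / 2 : ℝ) (dblGamma (h𝒜.genL d) X X))
  have h : S.Gamma₂ X.1 X.1 = (1 / 4 : ℝ) • (quadGamma₂ (h𝒜.genL d) X).1 := by
    have h1 : S.Gamma X.1 (S.matGenerator X.1)
      = (1 / 2 : ℝ) • (dblGamma (h𝒜.genL d) X (h𝒜.genL d X)).1 := rfl
    have h2 : S.Gamma (S.matGenerator X.1) X.1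
      = (1 / 2 : ℝ) • (dblGamma (h𝒜.genL d) (h𝒜.genL d X) X).1 := rfl
    rw [Gamma₂, e, h1, h2, ← smul_sub, ← smul_sub, smul_smul]
    norm_num
    rfl
  rw [h, smul_smul]
  norm_num

theorem _root_.IsSuitableMat.sub_matExpect {X : Ω → Matrix (Fin d) (Fin d) ℂ}
    (hX : IsSuitableMat 𝒜 X) : IsSuitableMat 𝒜 fun z => X z - matExpect μ X := by
  have h := Subalgebra.sub_mem _ hX.mem (const_mem_matAlgebra (𝒜 := 𝒜) (matExpect μ X))
  exact ⟨fun z => (hX.isHermitian z).sub (matExpect_isHermitian hX.isHermitian),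
    fun i j => (h i j).1, fun i j => (h i j).2⟩

variable [IsProbabilityMeasure μ]

theorem memLp_cfc (h𝒜 : S.IsSuitable μ 𝒜) {X : Ω → Matrix (Fin d) (Fin d) ℂ}
    (hX : X ∈ matAlgebra 𝒜 d) (hH : ∀ z, (X z).IsHermitian) {φ : ℝ → ℝ} (hφ : Continuous φ)
    {C r : ℝ} (hC : 0 ≤ C) (hr : 0 ≤ r) (h : ∀ x, |φ x| ≤ C * |x| ^ r) {p : ENNReal}
    (hp : p ≠ ⊤) : MemLp (fun z => cfc φ (X z)) p μ :=
  memLp_of_norm_le_rpow (fun _ hp => h𝒜.mat_memLp hX hp)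
    (stronglyMeasurable_cfc (h𝒜.mat_stronglyMeasurable hX) hH hφ).aestronglyMeasurable hr
    (fun z => norm_cfc_le_rpow (hH z) hC hr h) hp

theorem integrable_re_trace_cfc (h𝒜 : S.IsSuitable μ 𝒜) {X : Ω → Matrix (Fin d) (Fin d) ℂ}
    (hX : X ∈ matAlgebra 𝒜 d) (hH : ∀ z, (X z).IsHermitian) {φ : ℝ → ℝ} (hφ : Continuous φ)
    {r : ℝ} (hr : 0 ≤ r) (h : ∀ x, |φ x| ≤ |x| ^ r) :
    Integrable (fun z => (cfc φ (X z)).trace.re) μ :=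
  (traceReCLM d).integrable_comp (memLp_one_iff_integrable.1
    (h𝒜.memLp_cfc hX hH hφ zero_le_one hr (by simpa using h) (by simp)))

theorem integrable_re_trace_abs_rpow (h𝒜 : S.IsSuitable μ 𝒜)
    {X : Ω → Matrix (Fin d) (Fin d) ℂ} (hX : IsSuitableMat 𝒜 X) {q : ℝ} (hq : 1 ≤ q) :
    Integrable (fun z => (cfc (fun x : ℝ => |x| ^ (2 * q)) (X z)).trace.re) μ :=
  h𝒜.integrable_re_trace_cfc hX.mem hX.isHermitian (continuous_abs_rpow hq)
    (by linarith : 0 ≤ 2 * q) fun x =>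
      (abs_of_nonneg (Real.rpow_nonneg (abs_nonneg x) _)).le

theorem integrable_re_trace_Gamma_rpow (h𝒜 : S.IsSuitable μ 𝒜)
    {X : Ω → Matrix (Fin d) (Fin d) ℂ} (hX : IsSuitableMat 𝒜 X) {q : ℝ} (hq : 1 ≤ q) :
    Integrable (fun z => (cfc (fun x : ℝ => x ^ q) (S.Gamma X X z)).trace.re) μ :=
  h𝒜.integrable_re_trace_cfc (h𝒜.Gamma_mem hX.mem hX.mem)
    (fun z => (h𝒜.Gamma_posSemidef hX z).isHermitian)
    -- Values of `x ^ q` at negative `x` do not matter for a positive semidefinite matrix;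
    -- continuity and growth hold on the whole line all the same.
    (Real.continuous_rpow_const (by linarith)) (by linarith) fun x =>
      Real.abs_rpow_le_abs_rpow x q

theorem matExpect_sub_matExpect (h𝒜 : S.IsSuitable μ 𝒜) {X : Ω → Matrix (Fin d) (Fin d) ℂ}
    (hX : IsSuitableMat 𝒜 X) : matExpect μ (fun z => X z - matExpect μ X) = 0 := by
  have hi : Integrable X μ := memLp_one_iff_integrable.1 (h𝒜.mat_memLp hX.mem (by simp))
  have hs : Integrable (fun z => X z - matExpect μ X) μ := hi.sub (integrable_const _)
  rw [matExpect_eq_integral hs, integral_sub hi (integrable_const _),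
    integral_const, probReal_univ, one_smul, matExpect_eq_integral hi, sub_self]

/-- Ergodicity, on suitable matrix-valued functions of mean zero. -/
theorem tendsto_seminormL2_actL (h𝒜 : S.IsSuitable μ 𝒜) (herg : S.IsErgodic μ)
    (F : matAlgebra 𝒜 d) (hF : matExpect μ F.1 = 0) :
    Tendsto (fun t : ℝ => h𝒜.seminormL2 d (h𝒜.actL d t F)) atTop (𝓝 0) := by
  have hi (i j : Fin d) : Integrable (fun z => F.1 z i j) μ :=
    (entryCLM i j).integrable_comp
      (memLp_one_iff_integrable.1 (h𝒜.mat_memLp F.2 (p := 1) (by simp)))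
  have hz (i j : Fin d) : ∫ z, F.1 z i j ∂μ = 0 := congrFun (congrFun hF i) j
  have hre (i j : Fin d) : ∫ z, (F.1 z i j).re ∂μ = 0 := by
    have := Complex.reCLM.integral_comp_comm (hi i j)
    rw [hz] at this
    exact this
  have him (i j : Fin d) : ∫ z, (F.1 z i j).im ∂μ = 0 := by
    have := Complex.imCLM.integral_comp_comm (hi i j)
    rw [hz] at this
    exact this
  have h1 : Tendsto (fun t : NNReal => eLpNorm (S.matAct t F.1) 2 μ) atTop (𝓝 0) := by
    refine tendsto_eLpNorm_of_entries
      (fun t i j => h𝒜.measurable _ (h𝒜.matAct_mem F.2 t i j).1)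
      (fun t i j => h𝒜.measurable _ (h𝒜.matAct_mem F.2 t i j).2) (fun i j => ?_) fun i j => ?_
    · have h := herg _ (h𝒜.memLp _ (F.2 i j).1)
      simp only [hre, sub_zero] at h
      simp only [h𝒜.matAct_re F.2]
      exact h
    · have h := herg _ (h𝒜.memLp _ (F.2 i j).2)
      simp only [him, sub_zero] at h
      simp only [h𝒜.matAct_im F.2]
      exact h
  have h2 := (ENNReal.tendsto_toReal ENNReal.zero_ne_top).comp
    (h1.comp tendsto_real_toNNReal_atTop)
  rw [ENNReal.toReal_zero] at h2
  exact h2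

/-- The weight sits at `Z_0` and `Γ` at `Z_t`. Young's inequality for two unrelated matrices applies
pointwise, and both marginals are `μ`, so the bound does not depend on `t`. -/
theorem pairL_actL_dblGamma_le (h𝒜 : S.IsSuitable μ 𝒜) (hstat : S.IsStationary μ)
    {c q : ℝ} (hc : 0 < c) (hq : 1 ≤ q) (F : matAlgebra 𝒜 d) (hF : IsSuitableMat 𝒜 F.1)
    (hΨ : MemLp (fun z => cfc (fun x : ℝ => (2 * q - 1) * |x| ^ (2 * q - 2)) (F.1 z)) 2 μ)
    (t : ℝ) :
    c / 2 * h𝒜.pairL hΨ (h𝒜.actL d t (dblGamma (h𝒜.genL d) F F))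
      ≤ (c * (2 * q - 1)) ^ q / q
          * ∫ z, (cfc (fun x : ℝ => x ^ q) (S.Gamma F.1 F.1 z)).trace.re ∂μ
        + (1 - 1 / q) * ∫ z, (cfc (fun x : ℝ => |x| ^ (2 * q)) (F.1 z)).trace.re ∂μ := by
  have mp1 := S.measurePreserving_fst (μ := μ) t.toNNReal
  have mp2 := hstat.measurePreserving_snd t.toNNReal
  have iG := h𝒜.integrable_re_trace_Gamma_rpow hF hq
  have iM := h𝒜.integrable_re_trace_abs_rpow hF hq
  rw [h𝒜.pairL_actL hstat, ← integral_const_mul, ← integral_const_mul, ← integral_const_mul,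
    ← integral_comp_of_measurePreserving mp2 (iG.1.const_mul _),
    ← integral_comp_of_measurePreserving mp1 (iM.1.const_mul _), ← integral_add]
  · refine integral_mono ?_ ?_ fun p => ?_
    · exact (integrable_traceRe_mul (p := 2) (q := 2) (hΨ.comp_measurePreserving mp1)
        ((h𝒜.mat_memLp (dblGamma (h𝒜.genL d) F F).2 (by simp)).comp_measurePreserving
          mp2)).const_mul _
    · exact (mp2.integrable_comp_of_integrable (iG.const_mul _)).add
        (mp1.integrable_comp_of_integrable (iM.const_mul _))
    · have h := re_trace_mul_cfc_rpow_le (h𝒜.Gamma_posSemidef hF p.2) (hF.isHermitian p.1)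
        hc.le hq
      refine le_trans (le_of_eq ?_) h
      simp only [h𝒜.dblGamma_genL, Pi.smul_apply, Matrix.mul_smul, Matrix.trace_smul,
        Complex.smul_re, smul_eq_mul]
      rw [trace_mul_re_comm]
      ring
  · exact mp2.integrable_comp_of_integrable (iG.const_mul _)
  · exact mp1.integrable_comp_of_integrable (iM.const_mul _)

theorem pairL_dblGamma_actL_le (h𝒜 : S.IsSuitable μ 𝒜) (hstat : S.IsStationary μ)
    {c : ℝ} (hc : 0 < c) (hBE : S.BakryEmery μ 𝒜 d c) (F : matAlgebra 𝒜 d)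
    (hF : IsSuitableMat 𝒜 F.1) {ψ : ℝ → ℝ} (hψ : ∀ x, 0 ≤ ψ x)
    (hΨ : MemLp (fun z => cfc ψ (F.1 z)) 2 μ) (hΨ4 : MemLp (fun z => cfc ψ (F.1 z)) 4 μ)
    {t : ℝ} (ht : 0 ≤ t) :
    h𝒜.pairL hΨ (dblGamma (h𝒜.genL d) (h𝒜.actL d t F) (h𝒜.actL d t F))
      ≤ Real.exp (-(2 * t / c)) * h𝒜.pairL hΨ (h𝒜.actL d t (dblGamma (h𝒜.genL d) F F)) := by
  refine (h𝒜.isProductBounded_pairL hstat hΨ hΨ4).dblGamma_semigroup_le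
    (h𝒜.isContractionCalculus hstat d) ht hc F fun r v _ _ => ?_
  refine h𝒜.pairL_actL_nonneg hstat hΨ (fun z A hA => ?_) r _ ?_
  · rw [trace_mul_re_comm]
    exact re_trace_mul_cfc_nonneg hA (hF.isHermitian z) hψ
  · filter_upwards [hBE _ (h𝒜.matAct_isSuitableMat hF v.toNNReal)] with z hz
    have e : (c • quadGamma₂ (h𝒜.genL d) (h𝒜.actL d v F)
        - (2 : ℝ) • dblGamma (h𝒜.genL d) (h𝒜.actL d v F) (h𝒜.actL d v F)).1 z
        = (4 : ℝ) • (c • S.Gamma₂ (h𝒜.actL d v F).1 (h𝒜.actL d v F).1 z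
          - S.Gamma (h𝒜.actL d v F).1 (h𝒜.actL d v F).1 z) := by
      have e1 : (c • quadGamma₂ (h𝒜.genL d) (h𝒜.actL d v F)
        - (2 : ℝ) • dblGamma (h𝒜.genL d) (h𝒜.actL d v F) (h𝒜.actL d v F)).1 z
        = c • (quadGamma₂ (h𝒜.genL d) (h𝒜.actL d v F)).1 z
          - (2 : ℝ) • (dblGamma (h𝒜.genL d) (h𝒜.actL d v F) (h𝒜.actL d v F)).1 z := rfl
      rw [e1, quadGamma₂_genL, dblGamma_genL, Pi.smul_apply, Pi.smul_apply, smul_smul, smul_sub,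
        smul_smul, smul_smul, mul_comm c]
      norm_num
    rw [e]
    exact hz.smul (by norm_num)

/-- The polynomial moment inequality for a suitable function of mean zero. -/
theorem integral_re_trace_abs_rpow_le (h𝒜 : S.IsSuitable μ 𝒜) (hstat : S.IsStationary μ)
    (hrev : S.IsReversible μ) (herg : S.IsErgodic μ) {c : ℝ} (hc : 0 < c)
    (hBE : S.BakryEmery μ 𝒜 d c) {f : Ω → Matrix (Fin d) (Fin d) ℂ} (hf : IsSuitableMat 𝒜 f)
    (hf0 : matExpect μ f = 0) {q : ℝ} (hq : q = 1 ∨ 3 / 2 ≤ q) :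
    ∫ z, (cfc (fun x : ℝ => |x| ^ (2 * q)) (f z)).trace.re ∂μ
      ≤ (c * (2 * q - 1)) ^ q
        * ∫ z, (cfc (fun x : ℝ => x ^ q) (S.Gamma f f z)).trace.re ∂μ := by
  have hq1 : 1 ≤ q := by rcases hq with h | h <;> linarith
  have hp : 2 * q - 2 = 0 ∨ 1 ≤ 2 * q - 2 := by
    rcases hq with rfl | h
    · left; norm_num
    · right; linarith
  set φ : ℝ → ℝ := fun x => x * |x| ^ (2 * q - 2) with hφ_def
  set ψ : ℝ → ℝ := fun x => (2 * q - 1) * |x| ^ (2 * q - 2) with hψ_def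
  have hψ : ∀ x, 0 ≤ ψ x := fun x =>
    mul_nonneg (by linarith) (Real.rpow_nonneg (abs_nonneg x) _)
  -- The constant `2q - 1` is `p + 1` in the trapezoidal bound with `p = 2q - 2`.
  have hφψ : ∀ a b, |φ a - φ b| ≤ |a - b| * ((ψ a + ψ b) / 2) := fun a b => by
    have := abs_mul_rpow_sub_le hp a b
    rwa [show 2 * q - 2 + 1 = 2 * q - 1 by ring] at this
  have mΦ (p : ENNReal) (hp : p ≠ ⊤) : MemLp (fun z => cfc φ (f z)) p μ :=
    h𝒜.memLp_cfc hf.mem hf.isHermitian (continuous_mul_abs_rpow hq1) zero_le_one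
      (by linarith : 0 ≤ 2 * q - 1) (abs_mul_abs_rpow hq1) hp
  have mΨ (p : ENNReal) (hp : p ≠ ⊤) : MemLp (fun z => cfc ψ (f z)) p μ :=
    h𝒜.memLp_cfc hf.mem hf.isHermitian (continuous_const_mul_abs_rpow hq1)
      (by linarith : 0 ≤ 2 * q - 1) (by linarith : 0 ≤ 2 * q - 2)
      (fun x => (abs_of_nonneg (hψ x)).le) hp
  have hΦ := mΦ 2 (by simp)
  have hΦ4 := mΦ 4 (by simp)
  have hΨ := mΨ 2 (by simp)
  have hΨ4 := mΨ 4 (by simp)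
  set F : matAlgebra 𝒜 d := ⟨f, hf.mem⟩
  have H := h𝒜.isContractionCalculus hstat d
  have bΦ := h𝒜.isProductBounded_pairL hstat hΦ hΦ4
  set M := ∫ z, (cfc (fun x : ℝ => |x| ^ (2 * q)) (f z)).trace.re ∂μ with hM
  set G := ∫ z, (cfc (fun x : ℝ => x ^ q) (S.Gamma f f z)).trace.re ∂μ with hG
  set B := (c * (2 * q - 1)) ^ q / q * G + (1 - 1 / q) * M with hB
  have young : ∀ t, h𝒜.pairL hΨ (h𝒜.actL d t (dblGamma (h𝒜.genL d) F F)) ≤ 2 / c * B := fun t => by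
    have h := h𝒜.pairL_actL_dblGamma_le hstat hc hq1 F hf hΨ t
    have e : h𝒜.pairL hΨ (h𝒜.actL d t (dblGamma (h𝒜.genL d) F F))
        = 2 / c * (c / 2 * h𝒜.pairL hΨ (h𝒜.actL d t (dblGamma (h𝒜.genL d) F F))) := by
      field_simp
    rw [e]
    exact mul_le_mul_of_nonneg_left h (by positivity)
  -- The choice `τ = e^(-t/c)` balances `Γ(F)` against `Γ(P_t F)`, which carries `e^(-2t/c)`. Each
  -- contributes `e^(-t/c) · 2B/c`, and the prefactor `1/4` leaves an integrand whose integral over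
  -- `t > 0` is `B`.
  have hslope : ∀ t, 0 ≤ t →
      -h𝒜.pairL hΦ (h𝒜.actL d t (h𝒜.genL d F)) ≤ 1 / c * Real.exp (-(t / c)) * B := by
    intro t ht
    have e := bΦ.congr H (H.gen_comm ht F)
    rw [← e]
    refine (h𝒜.neg_pairL_genL_le hstat hrev (F := F) (G := h𝒜.actL d t F) hf.isHermitian
      (matAct_isHermitian hf.isHermitian _) hφψ hψ hΦ hΨ hΦ4 hΨ4 (Real.exp_pos (-(t / c)))).trans ?_
    have y0 := young 0
    rw [H.zero] at y0
    have yt := (h𝒜.pairL_dblGamma_actL_le hstat hc hBE F hf hψ hΨ hΨ4 ht).trans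
      (mul_le_mul_of_nonneg_left (young t) (Real.exp_pos _).le)
    have h1 := mul_le_mul_of_nonneg_left y0 (Real.exp_pos (-(t / c))).le
    have h2 := mul_le_mul_of_nonneg_left yt (inv_pos.2 (Real.exp_pos (-(t / c)))).le
    have e2 : (Real.exp (-(t / c)))⁻¹ * (Real.exp (-(2 * t / c)) * (2 / c * B))
        = Real.exp (-(t / c)) * (2 / c * B) := by
      rw [← mul_assoc, ← Real.exp_neg, ← Real.exp_add]
      congr 2
      ring
    rw [e2] at h2
    refine (mul_le_mul_of_nonneg_left (add_le_add h1 h2) (by norm_num)).trans_eq ?_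
    ring
  have hmono : ∀ t, 0 ≤ t → Real.exp (-(t / c)) * B - h𝒜.pairL hΦ (h𝒜.actL d t F) ≤ B - M := by
    intro t ht
    have hexp : ∀ s : ℝ, HasDerivAt (fun s : ℝ => Real.exp (-(s / c)) * B)
        (-(1 / c * Real.exp (-(s / c)) * B)) s := fun s => by
      have h1 : HasDerivAt (fun s : ℝ => -(s / c)) (-(1 / c)) s :=
        ((hasDerivAt_id s).div_const c).neg
      exact (h1.exp.mul_const B).congr_deriv (by ring)
    have e0 : h𝒜.pairL hΦ (h𝒜.actL d 0 F) = M := by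
      rw [H.zero, pairL_apply]
      refine integral_congr_ae (Eventually.of_forall fun z => ?_)
      exact (trace_mul_re_comm _ _).trans (re_trace_mul_cfc_self (hf.isHermitian z) hq1)
    refine image_le_of_deriv_right_le_deriv_boundary (a := 0) (b := t)
      (f := fun s => Real.exp (-(s / c)) * B - h𝒜.pairL hΦ (h𝒜.actL d s F))
      (f' := fun s => -(1 / c * Real.exp (-(s / c)) * B)
        - h𝒜.pairL hΦ (h𝒜.actL d s (h𝒜.genL d F)))
      (B := fun _ => B - M) (B' := fun _ => 0)
      ((Continuous.continuousOn (by fun_prop)).sub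
        ((bΦ.continuousOn_semigroup H F).mono Set.Icc_subset_Ici_self))
      (fun s hs => (hexp s).hasDerivWithinAt.sub (bΦ.hasDerivWithinAt_semigroup H F hs.1))
      (by simp [e0]) continuousOn_const (fun s _ => hasDerivWithinAt_const _ _ _)
      (fun s hs => by linarith [hslope s hs.1]) (Set.right_mem_Icc.2 ht)
  have hlim : Tendsto (fun t : ℝ => Real.exp (-(t / c)) * B - h𝒜.pairL hΦ (h𝒜.actL d t F)) atTop
      (𝓝 (0 * B - 0)) :=
    ((Real.tendsto_exp_neg_atTop_nhds_zero.comp (tendsto_id.atTop_div_const hc)).mul_const B).sub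
      (bΦ.tendsto_of_null H (h𝒜.tendsto_seminormL2_actL herg F hf0))
  rw [zero_mul, sub_zero] at hlim
  -- As `t → ∞` both terms vanish, the second by ergodicity. Thus `M ≤ B`, and the share `(1 - 1/q)
  -- M` of `B` is absorbed on the left; this is legitimate because `M` is a finite real number.
  have hBM : 0 ≤ B - M := le_of_tendsto hlim (by
    filter_upwards [eventually_ge_atTop 0] with t ht using hmono t ht)
  have hq0 : 0 < q := by linarith
  have h3 : q * (B - M) = (c * (2 * q - 1)) ^ q * G - M := by
    rw [hB]; field_simp; ring
  have h4 := mul_nonneg hq0.le hBM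
  rw [h3] at h4
  linarith

theorem integral_re_trace_Gamma_rpow_le (h𝒜 : S.IsSuitable μ 𝒜)
    {f : Ω → Matrix (Fin d) (Fin d) ℂ} (hf : IsSuitableMat 𝒜 f) {q : ℝ} (hq : 1 ≤ q)
    (hv : S.varianceProxy μ f < ⊤) :
    ∫ z, (cfc (fun x : ℝ => x ^ q) (S.Gamma f f z)).trace.re ∂μ
      ≤ d * (S.varianceProxy μ f).toReal ^ q := by
  have hb : ∀ᵐ z ∂μ, ‖S.Gamma f f z‖ ≤ (S.varianceProxy μ f).toReal := by
    have h := ae_le_eLpNormEssSup (f := fun z => specNorm (S.Gamma f f z)) (μ := μ)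
    filter_upwards [h] with z hz
    rw [← eLpNorm_exponent_top] at hz
    have := ENNReal.toReal_mono hv.ne hz
    rwa [toReal_enorm, specNorm_eq_norm, norm_norm] at this
  have h := integral_mono_ae (h𝒜.integrable_re_trace_Gamma_rpow hf hq)
    (integrable_const (d * (S.varianceProxy μ f).toReal ^ q)) (by
      filter_upwards [hb] with z hz
      exact (h𝒜.Gamma_posSemidef hf z).re_trace_cfc_rpow_le (by linarith) hz)
  rwa [integral_const, probReal_univ, one_smul] at h

end IsSuitable

end MarkovSemigroup

end OperatorNorm

/-! ### Centring and extraction of roots. -/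

theorem theorem3p1 {Ω : Type*} [TopologicalSpace Ω] [PolishSpace Ω] [MeasurableSpace Ω]
    [BorelSpace Ω] (μ : Measure Ω) [IsProbabilityMeasure μ]
    (S : MarkovSemigroup Ω) (hstat : S.IsStationary μ) (hrev : S.IsReversible μ)
    (herg : S.IsErgodic μ)
    (𝒜 : Subalgebra ℝ (Ω → ℝ)) (h𝒜 : S.IsSuitable μ 𝒜)
    (d : ℕ) (c : ℝ) (hc : 0 < c) (hBE : S.BakryEmery μ 𝒜 d c)
    (f : Ω → Matrix (Fin d) (Fin d) ℂ) (hf : IsSuitableMat 𝒜 f)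
    (q : ℝ) (hq : q = 1 ∨ 3 / 2 ≤ q) :
    Integrable
      (fun z => (cfc (fun x : ℝ => |x| ^ (2 * q)) (f z - matExpect μ f)).trace.re) μ ∧
    Integrable (fun z => (cfc (fun x : ℝ => x ^ q) (S.Gamma f f z)).trace.re) μ ∧
    (∫ z, (cfc (fun x : ℝ => |x| ^ (2 * q)) (f z - matExpect μ f)).trace.re ∂μ) ^ (1 / (2 * q))
      ≤ Real.sqrt (c * (2 * q - 1)) *
        (∫ z, (cfc (fun x : ℝ => x ^ q) (S.Gamma f f z)).trace.re ∂μ) ^ (1 / (2 * q)) ∧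
    (S.varianceProxy μ f < ⊤ →
      (∫ z, (cfc (fun x : ℝ => |x| ^ (2 * q)) (f z - matExpect μ f)).trace.re ∂μ)
          ^ (1 / (2 * q))
        ≤ (d : ℝ) ^ (1 / (2 * q)) *
          Real.sqrt (c * (2 * q - 1) * (S.varianceProxy μ f).toReal)) := by
  have hq1 : 1 ≤ q := by rcases hq with h | h <;> linarith
  have hf0 := hf.sub_matExpect (μ := μ)
  have hM := h𝒜.integral_re_trace_abs_rpow_le hstat hrev herg hc hBE hf0
    (h𝒜.matExpect_sub_matExpect hf) hq
  -- The carré du champ does not see the subtracted mean, so the centred inequality is already about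
  -- `Γ(f)`.
  rw [h𝒜.Gamma_sub_const hf.mem] at hM
  have hM0 : 0 ≤ ∫ z, (cfc (fun x : ℝ => |x| ^ (2 * q)) (f z - matExpect μ f)).trace.re ∂μ :=
    integral_nonneg fun z => by
      rw [Pi.zero_apply, re_trace_cfc (hf0.isHermitian z)]
      exact Finset.sum_nonneg fun i _ => Real.rpow_nonneg (abs_nonneg _) _
  have hG0 : 0 ≤ ∫ z, (cfc (fun x : ℝ => x ^ q) (S.Gamma f f z)).trace.re ∂μ :=
    integral_nonneg fun z => (h𝒜.Gamma_posSemidef hf z).re_trace_cfc_rpow_nonneg q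
  have hr : 0 ≤ 1 / (2 * q) := by positivity
  have hsqrt : ∀ a : ℝ, 0 ≤ a → (a ^ q) ^ (1 / (2 * q)) = Real.sqrt a := fun a ha => by
    rw [← Real.rpow_mul ha, Real.sqrt_eq_rpow]
    congr 1
    field_simp
  have hk : 0 ≤ c * (2 * q - 1) := mul_nonneg hc.le (by linarith)
  refine ⟨h𝒜.integrable_re_trace_abs_rpow hf0 hq1, h𝒜.integrable_re_trace_Gamma_rpow hf hq1, ?_,
    fun hv => ?_⟩
  · refine (Real.rpow_le_rpow hM0 hM hr).trans_eq ?_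
    rw [Real.mul_rpow (Real.rpow_nonneg hk q) hG0, hsqrt _ hk]
  · have hG := h𝒜.integral_re_trace_Gamma_rpow_le hf hq1 hv
    have hv0 : 0 ≤ (S.varianceProxy μ f).toReal := ENNReal.toReal_nonneg
    have h := hM.trans (mul_le_mul_of_nonneg_left hG (Real.rpow_nonneg hk q))
    rw [mul_left_comm, ← Real.mul_rpow hk hv0] at h
    refine (Real.rpow_le_rpow hM0 h hr).trans_eq ?_
    rw [Real.mul_rpow (Nat.cast_nonneg d) (Real.rpow_nonneg (mul_nonneg hk hv0) q),
      hsqrt _ (mul_nonneg hk hv0)]
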